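/- Let $G$ be a locally compact (Hausdorff) group with a fixed left Haar measure $dx$ and modular function $\Delta$ (so $|Ex|=\Delta(x)|E|$). Let $Ruc(G)$ be the $C^*$-algebra, with the sup norm, of bounded continuous functions $n:G\to\mathbb C$ with $\sup_{x}|n(y^{-1}x)-n(x)|\to 0$ as $y\to e$, and put $(T_yn)(z)=n(y^{-1}z)$. Let $\mathcal L=L^1(G,Ruc(G),T)$ be the space of Bochner integrable functions $G\to Ruc(G)$ with norm $\|f\|=\int_G\|f(x)\|_\infty\,dx$, twisted convolution $$h\star f(x)=\int_G T_y(h(xy))\,f(y^{-1})\,dy$$ and involution $h^*(x)=\Delta(x^{-1})\,\overline{T_{x^{-1}}(h(x^{-1}))}$. An operator $A\in B(L^2(G))$ is called convolution dominated, $A\in CD$, if there is $a\in L^1(G)$ such that for every $f\in L^2(G)$ $$|Af(x)|\le (a\star|f|)(x)=\int_G a(y)\,|f(y^{-1}x)|\,dy\quad\text{for almost all }x\in G,$$ and $\|A\|_{CD}$ is the infimum of $\|a\|_1$ over all such $a$. Let $\lambda(y)f(x)=f(y^{-1}x)$ on $L^2(G)$, $\lambda(a)=\int_G a(y)\lambda(y)\,dy$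 for $a\in L^1(G)$ (as a strong integral), and $D^m f=mf$ for $m\in Ruc(G)$. Let $R:\mathcal L\to B(L^2(G))$ be given by $R(f)h=\int_G\lambda(y)\bigl(D^{f(y)}h\bigr)\,dy$ (a Bochner integral in $L^2(G)$). Then: 1. $R$ is the unique bounded linear map $\mathcal L\to B(L^2(G))$ with $R(a\otimes m)=\lambda(a)\circ D^m$ for all $a\in L^1(G)$, $m\in Ruc(G)$, where $(a\otimes m)(x)=a(x)m$. 2. $R$ is a $*$-algebra homomorphism: for all $h,f\in\mathcal L$, the integral defining $h\star f(x)$ converges absolutely for almost all $x$, $h\star f\in\mathcal L$, $h^*\in\mathcal L$, and $R(h\star f)=R(h)\circ R(f)$, $R(h^*)=R(h)^*$. 3. $R$ takes values in $CD$ and is isometric for the $CD$-norm: $\|R(f)\|_{CD}=\|f\|$ for all $f\in\mathcal L$. The image of $R$ is by definition $CD_{reg}$, the space of regular convolution dominated operators; thus $CD_{reg}\subseteq CD$. -/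

import Mathlib

open MeasureTheory Filter Topology
open scoped ENNReal NNReal BoundedContinuousFunction

noncomputable section

namespace ConvDom

/-! ### The `C*`-algebra of bounded right uniformly continuous functions -/

section Ruc

variable (G : Type*) [Group G] [TopologicalSpace G] [IsTopologicalGroup G]

/-- `Ruc(G)`: the bounded continuous functions `F` on `G` with
`sup_x |F (y⁻¹ x) - F x| → 0` as `y → 1`, i.e. those on which left translation acts norm
continuously.  It is a `*`-subalgebra of the bounded continuous functions with the sup norm. -/
def Ruc : StarSubalgebra ℂ (G →ᵇ ℂ) where
  carrier := {F | ∀ ε : ℝ, 0 < ε → ∀ᶠ y in 𝓝 (1 : G), ∀ x : G, ‖F (y⁻¹ * x) - F x‖ ≤ ε}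
  mul_mem' := by
    intro F H hF hH ε hε
    have hc : 0 < ‖F‖ + ‖H‖ + 1 := by positivity
    filter_upwards [hF (ε / (‖F‖ + ‖H‖ + 1)) (by positivity),
      hH (ε / (‖F‖ + ‖H‖ + 1)) (by positivity)] with y h1 h2 x
    have e : (F * H) (y⁻¹ * x) - (F * H) x
        = F (y⁻¹ * x) * (H (y⁻¹ * x) - H x) + (F (y⁻¹ * x) - F x) * H x := by
      simp only [BoundedContinuousFunction.mul_apply]; ring
    rw [e]
    calc _ ≤ ‖F‖ * (ε / (‖F‖ + ‖H‖ + 1)) + (ε / (‖F‖ + ‖H‖ + 1)) * ‖H‖ := by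
          refine (norm_add_le _ _).trans ?_
          rw [norm_mul, norm_mul]
          gcongr
          · exact F.norm_coe_le_norm _
          · exact h2 x
          · exact h1 x
          · exact H.norm_coe_le_norm _
      _ = (‖F‖ + ‖H‖) / (‖F‖ + ‖H‖ + 1) * ε := by ring
      _ ≤ 1 * ε := by
          gcongr
          rw [div_le_one hc]; linarith
      _ = ε := one_mul _
  add_mem' := by
    intro F H hF hH ε hε
    filter_upwards [hF (ε / 2) (by positivity), hH (ε / 2) (by positivity)] with y h1 h2 x
    have e : (F + H) (y⁻¹ * x) - (F + H) x
        = (F (y⁻¹ * x) - F x) + (H (y⁻¹ * x) - H x) := by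
      simp only [BoundedContinuousFunction.add_apply]; ring
    rw [e]
    refine (norm_add_le _ _).trans ?_
    linarith [h1 x, h2 x]
  algebraMap_mem' := by
    intro r ε hε
    refine Eventually.of_forall fun y x => ?_
    simp [hε.le]
  star_mem' := by
    intro F hF ε hε
    filter_upwards [hF ε hε] with y h x
    have e : (star F) (y⁻¹ * x) - (star F) x = star (F (y⁻¹ * x) - F x) := by
      simp
    rw [e, norm_star]
    exact h x

instance : CompleteSpace (Ruc G) := by
  have : IsClosed (Ruc G : Set (G →ᵇ ℂ)) := by
    rw [← isSeqClosed_iff_isClosed]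
    intro u F hu hF ε hε
    obtain ⟨n, hn⟩ := (Metric.tendsto_atTop.1 hF (ε / 3) (by positivity))
    have hn := (hn n le_rfl).le
    filter_upwards [hu n (ε / 3) (by positivity)] with y h x
    have h1 := (BoundedContinuousFunction.dist_coe_le_dist (f := u n) (g := F) (y⁻¹ * x)).trans hn
    have h2 := (BoundedContinuousFunction.dist_coe_le_dist (f := u n) (g := F) x).trans hn
    have h3 := h x
    rw [← dist_eq_norm] at h3 ⊢
    have h4 := dist_triangle4 (F (y⁻¹ * x)) (u n (y⁻¹ * x)) (u n x) (F x)
    rw [dist_comm (u n (y⁻¹ * x))] at h1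
    linarith
  exact this.completeSpace_coe

variable {G}

/-- Left translation `(T_y n)(z) = n (y⁻¹ z)` on `Ruc(G)`. -/
def trans (y : G) (n : Ruc G) : Ruc G :=
  ⟨(n : G →ᵇ ℂ).compContinuous ⟨fun z => y⁻¹ * z, by fun_prop⟩, by
    intro ε hε
    have hc : Tendsto (fun w : G => y⁻¹ * w * y) (𝓝 1) (𝓝 1) := by
      have : Continuous fun w : G => y⁻¹ * w * y := by fun_prop
      simpa using this.tendsto 1
    filter_upwards [hc.eventually (n.2 ε hε)] with w h x
    have := h (y⁻¹ * x)
    simpa [mul_assoc] using this⟩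

@[simp] lemma trans_apply (y : G) (n : Ruc G) (z : G) :
    (trans y n : G →ᵇ ℂ) z = (n : G →ᵇ ℂ) (y⁻¹ * z) := rfl

end Ruc

variable {G : Type*} [Group G] [TopologicalSpace G] [IsTopologicalGroup G] [LocallyCompactSpace G]

/-- The modular function `Δ` of `G`, normalised by `μ (E x) = Δ(x) μ(E)` for left Haar
measures `μ` (see `measure_mul_right`); Mathlib's `modularCharacter` is its inverse. -/
def Δ (x : G) : ℝ := (Measure.modularCharacterFun x⁻¹ : ℝ≥0)

variable [MeasurableSpace G] [BorelSpace G]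

lemma measure_mul_right (μ : Measure G) [μ.IsHaarMeasure] [μ.Regular] (x : G) (E : Set G) :
    μ ((fun z => z * x) '' E) = ENNReal.ofReal (Δ x) * μ E := by
  have hreg : (μ.map (fun z => z * x⁻¹)).Regular :=
    Measure.Regular.map (Homeomorph.mulRight x⁻¹)
  have h : μ.map (fun z => z * x⁻¹) = Measure.modularCharacterFun x⁻¹ • μ := by
    rw [Measure.modularCharacterFun_eq_haarScalarFactor μ]
    exact Measure.isMulLeftInvariant_eq_smul_of_regular _ μ
  have h2 : μ.map (fun z => z * x⁻¹) E = (Measure.modularCharacterFun x⁻¹ • μ) E := by rw [h]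
  rw [show (fun z => z * x⁻¹) = (Homeomorph.mulRight x⁻¹).toMeasurableEquiv from rfl,
    MeasurableEquiv.map_apply] at h2
  have e : ((Homeomorph.mulRight x⁻¹).toMeasurableEquiv : G → G) ⁻¹' E
      = (fun z => z * x) '' E := by
    ext z
    simp
  rw [e] at h2
  rw [h2, Δ, ENNReal.ofReal_coe_nnreal]
  rfl

variable (μ : Measure G) [μ.IsHaarMeasure]

/-! ### Convolution dominated operators -/

/-- `L²(G)`. -/
abbrev L2 : Type _ := Lp ℂ 2 μ

/-- The convolution `a ⋆ g (x) = ∫ a(y) g(y⁻¹ x) dy` of real valued functions. -/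
def conv (a g : G → ℝ) (x : G) : ℝ := ∫ y, a y * g (y⁻¹ * x) ∂μ

/-- `|A f| ≤ a ⋆ |f|` almost everywhere, for every `f ∈ L²(G)`. -/
def IsDominatedBy (A : L2 μ →L[ℂ] L2 μ) (a : Lp ℝ 1 μ) : Prop :=
  ∀ f : L2 μ, ∀ᵐ x ∂μ, ‖A f x‖ ≤ conv μ a (fun z => ‖f z‖) x

/-- The set `CD` of convolution dominated operators on `L²(G)`. -/
def CD : Set (L2 μ →L[ℂ] L2 μ) := {A | ∃ a : Lp ℝ 1 μ, IsDominatedBy μ A a}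

/-- The `CD`-norm, the infimum of the norms of the dominating functions. -/
def cdNorm (A : L2 μ →L[ℂ] L2 μ) : ℝ :=
  sInf {r : ℝ | ∃ a : Lp ℝ 1 μ, IsDominatedBy μ A a ∧ ‖a‖ = r}

/-! ### The twisted `L¹`-algebra -/

/-- The Banach space `L¹(G, Ruc(G))` of Bochner integrable functions. -/
abbrev TwistedL1 : Type _ := Lp (Ruc G) 1 μ

/-- The integrand of the twisted convolution, `y ↦ T_y (h (x y)) f (y⁻¹)`. -/
def twistedIntegrand (h f : G → Ruc G) (x y : G) : Ruc G := trans y (h (x * y)) * f y⁻¹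

/-- The twisted convolution `h ⋆ f (x) = ∫ T_y (h (x y)) f (y⁻¹) dy`. -/
def twistedConv (h f : G → Ruc G) (x : G) : Ruc G := ∫ y, twistedIntegrand h f x y ∂μ

/-- The involution `h* (x) = Δ(x⁻¹) conj (T_{x⁻¹} (h (x⁻¹)))`. -/
def twistedStar (h : G → Ruc G) (x : G) : Ruc G :=
  ((Δ x⁻¹ : ℝ) : ℂ) • star (trans x⁻¹ (h x⁻¹))

/-- The elementary tensor `a ⊗ m`, i.e. the class of `x ↦ a(x) m`. -/
def tensor (a : Lp ℂ 1 μ) (m : Ruc G) : TwistedL1 μ :=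
  (ContinuousLinearMap.toSpanSingleton ℂ m).compLp a

/-! ### The operators `λ(y)`, `D^m`, `λ(a)` -/

/-- The left regular representation `(λ(y) f)(x) = f (y⁻¹ x)` on `L²(G)`. -/
def lam (y : G) : L2 μ →ₗᵢ[ℂ] L2 μ :=
  Lp.compMeasurePreservingₗᵢ ℂ (fun x => y⁻¹ * x) (measurePreserving_mul_left μ y⁻¹)

lemma memLp_mul (m : Ruc G) (f : L2 μ) : MemLp (fun x => (m : G →ᵇ ℂ) x * f x) 2 μ :=
  (Lp.memLp f).of_le_mul (c := ‖m‖)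
    ((m : G →ᵇ ℂ).continuous.aestronglyMeasurable.mul (Lp.memLp f).1)
    (Eventually.of_forall fun x => by
      rw [norm_mul]
      gcongr
      exact (m : G →ᵇ ℂ).norm_coe_le_norm x)

/-- The multiplication operator `D^m f = m f` on `L²(G)`, as a bounded linear function of `m`. -/
def mulOp : Ruc G →L[ℂ] L2 μ →L[ℂ] L2 μ :=
  LinearMap.mkContinuous₂
    (LinearMap.mk₂ ℂ (fun m f => (memLp_mul μ m f).toLp _)
      (fun m n f => by
        apply Lp.ext
        filter_upwards [(memLp_mul μ (m + n) f).coeFn_toLp, (memLp_mul μ m f).coeFn_toLp,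
          (memLp_mul μ n f).coeFn_toLp,
          Lp.coeFn_add ((memLp_mul μ m f).toLp _) ((memLp_mul μ n f).toLp _)] with x h1 h2 h3 h4
        rw [h4, h1, Pi.add_apply, h2, h3]
        simp [add_mul])
      (fun c m f => by
        apply Lp.ext
        filter_upwards [(memLp_mul μ (c • m) f).coeFn_toLp, (memLp_mul μ m f).coeFn_toLp,
          Lp.coeFn_smul c ((memLp_mul μ m f).toLp _)] with x h1 h2 h4
        rw [h4, h1, Pi.smul_apply, h2]
        simp [mul_assoc])
      (fun m f g => by
        apply Lp.ext
        filter_upwards [(memLp_mul μ m (f + g)).coeFn_toLp, (memLp_mul μ m f).coeFn_toLp,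
          (memLp_mul μ m g).coeFn_toLp, Lp.coeFn_add f g,
          Lp.coeFn_add ((memLp_mul μ m f).toLp _) ((memLp_mul μ m g).toLp _)]
          with x h1 h2 h3 h5 h4
        rw [h4, h1, Pi.add_apply, h2, h3, h5]
        simp [mul_add])
      (fun c m f => by
        apply Lp.ext
        filter_upwards [(memLp_mul μ m (c • f)).coeFn_toLp, (memLp_mul μ m f).coeFn_toLp,
          Lp.coeFn_smul c f, Lp.coeFn_smul c ((memLp_mul μ m f).toLp _)] with x h1 h2 h3 h4
        rw [h4, h1, Pi.smul_apply, h2, h3]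
        simp [mul_left_comm]))
    1 (fun m f => by
      rw [one_mul]
      refine Lp.norm_le_mul_norm_of_ae_le_mul (f := (memLp_mul μ m f).toLp _) (g := f) ?_
      filter_upwards [(memLp_mul μ m f).coeFn_toLp] with x h1
      rw [h1, norm_mul]
      gcongr
      exact (m : G →ᵇ ℂ).norm_coe_le_norm x)

lemma mulOp_apply (m : Ruc G) (f : L2 μ) :
    mulOp μ m f =ᵐ[μ] fun x => (m : G →ᵇ ℂ) x * f x :=
  (memLp_mul μ m f).coeFn_toLp

lemma norm_mulOp_le : ‖mulOp μ‖ ≤ 1 := LinearMap.mkContinuous₂_norm_le _ zero_le_one _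

section Integrated

variable [μ.Regular]

lemma continuous_lam [T2Space G] (h : L2 μ) : Continuous fun y : G => lam μ y h := by
  have hc : Continuous fun y : G => (⟨fun x => y⁻¹ * x, by fun_prop⟩ : C(G, G)) :=
    ContinuousMap.continuous_of_continuous_uncurry _ (by
      simp only [Function.uncurry_def, ContinuousMap.coe_mk]; fun_prop)
  exact Continuous.compMeasurePreservingLp (f := fun _ : G => h) continuous_const hc
    (fun y => measurePreserving_mul_left μ y⁻¹) (by simp)

variable [T2Space G] {E : Type*} [NormedAddCommGroup E] [NormedSpace ℂ E]

lemma aestronglyMeasurable_lam (P : E →L[ℂ] L2 μ →L[ℂ] L2 μ) (f : G → E) (hf : Integrable f μ)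
    (h : L2 μ) : AEStronglyMeasurable (fun y => lam μ y (P (f y) h)) μ := by
  revert f
  apply Integrable.induction
  · intro c s hs hμs
    have e : (fun y => lam μ y (P (s.indicator (fun _ => c) y) h))
        = s.indicator (fun y => lam μ y (P c h)) := by
      ext1 y
      by_cases hy : y ∈ s <;> simp [hy]
    rw [e, aestronglyMeasurable_indicator_iff hs]
    choose K hKs hK hKμ using fun n : ℕ =>
      hs.exists_isCompact_sdiff_lt hμs.ne (ε := ((n : ℝ≥0∞) + 1)⁻¹) (by simp)
    have hU : μ (s \ ⋃ n, K n) = 0 := by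
      refine le_antisymm (ge_of_tendsto' (x := atTop) (f := fun n : ℕ => ((n : ℝ≥0∞) + 1)⁻¹)
        ?_ fun n => ?_) bot_le
      · have := (tendsto_add_atTop_iff_nat 1).2 ENNReal.tendsto_inv_nat_nhds_zero
        simpa using this
      · exact (measure_mono (Set.sdiff_subset_sdiff_right (Set.subset_iUnion K n))).trans (hKμ n).le
    have hr : μ.restrict s = μ.restrict (⋃ n, K n) := by
      refine Measure.restrict_congr_set (ae_eq_set.2 ⟨hU, ?_⟩)
      rw [Set.sdiff_eq_empty.2 (Set.iUnion_subset hKs), measure_empty]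
    rw [hr, aestronglyMeasurable_iUnion_iff]
    exact fun n => (continuous_lam μ (P c h)).continuousOn.aestronglyMeasurable_of_isCompact (hK n)
      (hK n).measurableSet
  · intro f g _ _ _ hf hg
    refine (hf.add hg).congr (Eventually.of_forall fun y => ?_)
    simp
  · rw [← isSeqClosed_iff_isClosed]
    intro u f hu hf
    obtain ⟨φ, -, hφ⟩ := (tendstoInMeasure_of_tendsto_Lp hf).exists_seq_tendsto_ae
    refine aestronglyMeasurable_of_tendsto_ae atTop (fun n => hu (φ n)) ?_
    filter_upwards [hφ] with y hy
    exact ((lam μ y).continuous.comp ((P.flip h).continuous)).continuousAt.tendsto.comp hy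
  · intro f g hfg _ hf
    refine hf.congr ?_
    filter_upwards [hfg] with y hy
    rw [hy]

lemma integrable_lam (P : E →L[ℂ] L2 μ →L[ℂ] L2 μ) (f : Lp E 1 μ) (h : L2 μ) :
    Integrable (fun y => lam μ y (P (f y) h)) μ := by
  have hf := L1.integrable_coeFn f
  refine (hf.norm.const_mul (‖P‖ * ‖h‖)).mono'
    (aestronglyMeasurable_lam μ P f hf h) (Eventually.of_forall fun y => ?_)
  rw [LinearIsometry.norm_map]
  linarith [P.le_opNorm₂ (f y) h]

/-- For a bounded family of operators `P v`, linear in `v`, the bilinear map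
`(f, h) ↦ ∫ λ(y) (P (f y) h) dy`, a Bochner integral in `L²(G)`. -/
def integrated (P : E →L[ℂ] L2 μ →L[ℂ] L2 μ) : Lp E 1 μ →L[ℂ] L2 μ →L[ℂ] L2 μ :=
  LinearMap.mkContinuous₂
    (LinearMap.mk₂ ℂ (fun f h => ∫ y, lam μ y (P (f y) h) ∂μ)
      (fun f g h => by
        rw [← integral_add (integrable_lam μ P f h) (integrable_lam μ P g h)]
        refine integral_congr_ae ?_
        filter_upwards [Lp.coeFn_add f g] with y hy
        simp only [hy, Pi.add_apply, map_add, add_apply])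
      (fun c f h => by
        rw [← integral_smul]
        refine integral_congr_ae ?_
        filter_upwards [Lp.coeFn_smul c f] with y hy
        simp only [hy, Pi.smul_apply, map_smul, smul_apply])
      (fun f h k => by
        rw [← integral_add (integrable_lam μ P f h) (integrable_lam μ P f k)]
        simp)
      (fun c f h => by
        rw [← integral_smul]
        simp))
    ‖P‖ (fun f h => by
      refine (norm_integral_le_of_norm_le
        ((L1.integrable_coeFn f).norm.const_mul (‖P‖ * ‖h‖))
        (Eventually.of_forall fun y => ?_)).trans_eq ?_
      · rw [LinearIsometry.norm_map]
        linarith [P.le_opNorm₂ (f y) h]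
      · rw [integral_const_mul, ← L1.norm_eq_integral_norm]
        ring)

/-- The integrated left regular representation `λ(a) h = ∫ a(y) λ(y) h dy`, `a ∈ L¹(G)`. -/
def lamInt : Lp ℂ 1 μ →L[ℂ] L2 μ →L[ℂ] L2 μ :=
  integrated μ (ContinuousLinearMap.toSpanSingleton ℂ (ContinuousLinearMap.id ℂ (L2 μ)))

lemma lamInt_apply (a : Lp ℂ 1 μ) (h : L2 μ) :
    lamInt μ a h = ∫ y, a y • lam μ y h ∂μ :=
  integral_congr_ae (Eventually.of_forall fun y => by simp)

/-- The map `R : L¹(G, Ruc(G)) → B(L²(G))`, `R(f) h = ∫ λ(y) (D^{f(y)} h) dy`. -/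
def R : TwistedL1 μ →L[ℂ] L2 μ →L[ℂ] L2 μ := integrated μ (mulOp μ)

lemma R_apply (f : TwistedL1 μ) (h : L2 μ) :
    R μ f h = ∫ y, lam μ y (mulOp μ (f y) h) ∂μ := rfl

/-- The regular convolution dominated operators: the image of `R`. -/
def CDreg : Submodule ℂ (L2 μ →L[ℂ] L2 μ) := LinearMap.range (R μ).toLinearMap

end Integrated

end ConvDom

end

/-!
# Regular convolution dominated operators

The group is not assumed to be second countable or `σ`-compact, so product measures and the usual
Fubini theorems are not available.  Instead, every element of `Lp` is written as a series of
compactly supported continuous functions that converges absolutely in norm and almost everywhere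
(`exists_series_cc`); for such functions Fubini's theorem holds without countability assumptions.

The twisted convolution and the operators `R(f)` are two instances of one construction: for a
continuous family of contractive bilinear maps `B w : E × F → W`, `w ∈ G` (a `Pairing`), the
convolution of `h ∈ L¹(G, E)` and `f ∈ Lp(G, F)` is the Bochner integral
`∫ λ(y) (w ↦ B w (h y) (f w)) dy` in `Lp(G, W)`.  Its pointwise description
`x ↦ ∫ B(y⁻¹x) (h y) (f (y⁻¹x)) dy`, with absolute convergence almost everywhere, is
`Pairing.ae_integral_kernel`.

*Multiplicativity.*  As `h ⋆ f` is a Bochner integral in `L¹(G, Ruc(G))`, the bounded map `R` may be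
applied under the integral.  It then suffices that `R` intertwines left translation on
`L¹(G, Ruc(G))` with `λ(y)`, and the map `g ↦ (w ↦ T_{w⁻¹}(u) g(w))` with `D^u`.

*Involution.*  The substitution `y ↦ y⁻¹` has Jacobian `Δ(y⁻¹)`
(`integrable_integral_Δ_inv_smul`) and turns `⟪k, R(h) l⟫` into `⟪R(h*) k, l⟫`.

*Isometry.*  The pointwise formula shows that `R(f)` is dominated by `‖f(·)‖`.  Conversely let `a`
dominate `R(f)`, where `f` may be taken continuous with compact support (`IsDominatedBy.of_sub`).
Testing the domination inequality against approximate delta functions at `z` gives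
`Re (θ f(y)(z)) ≤ a(y)` for almost all `y`, for each `z ∈ G` and `|θ| ≤ 1` (`ae_re_le`).  The range
of `f` is separable, so countably many pairs `(θ, z)` recover the norm, whence `‖f(y)‖ ≤ a(y)`
almost everywhere (`ae_norm_le`).
-/


open CompactlySupported
open scoped InnerProductSpace

noncomputable section

namespace ConvDom

/-! ### Compactly supported continuous functions in `Lp` and series -/

section Series

variable {X : Type*} [MeasurableSpace X] {μ : Measure X}
  {E : Type*} [NormedAddCommGroup E] [CompleteSpace E]

/-- If `∑ ∫ ‖F n‖ < ∞` and `∑ F n = K` almost everywhere, then `K` is integrable and the series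
may be integrated term by term. -/
lemma integrable_of_hasSum [NormedSpace ℝ E] {F : ℕ → X → E} {K : X → E}
    (hF : ∀ n, Integrable (F n) μ) (hs : Summable fun n => ∫ y, ‖F n y‖ ∂μ)
    (hK : ∀ᵐ y ∂μ, HasSum (fun n => F n y) (K y)) :
    Integrable K μ ∧ HasSum (fun n => ∫ y, F n y ∂μ) (∫ y, K y ∂μ) := by
  have hn : ∀ n, ‖(hF n).toL1 (F n)‖ = ∫ y, ‖F n y‖ ∂μ := fun n => by
    rw [L1.norm_eq_integral_norm]
    refine integral_congr_ae ?_
    filter_upwards [(hF n).coeFn_toL1] with y hy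
    rw [hy]
  have hs1 : Summable fun n => ‖(hF n).toL1 (F n)‖ := by simpa only [hn] using hs
  -- `K` represents the sum of the series in `L¹`, which converges almost everywhere as well.
  have hae : K =ᵐ[μ] ⇑(∑' n, (hF n).toL1 (F n)) := by
    have h2 := Lp.hasSum_coeFn_tsum (f := fun n => (hF n).toL1 (F n))
      (tsum_enorm_ne_top_iff_summable_norm.2 hs1)
    filter_upwards [hK, h2, ae_all_iff.2 fun n => (hF n).coeFn_toL1] with y h3 h4 h5
    simp only [h5] at h4
    exact h3.unique h4
  have hi : Integrable K μ := (L1.integrable_coeFn _).congr hae.symm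
  refine ⟨hi, ?_⟩
  have h6 := (L1.integralCLM (α := X) (E := E) (μ := μ)).hasSum hs1.of_norm.hasSum
  simp only [← L1.integral_eq, ← integral_eq] at h6
  rwa [L1.integral_eq_integral, ← integral_congr_ae hae] at h6

end Series

section CompactSupport

variable {G : Type*} [TopologicalSpace G] [MeasurableSpace G] [BorelSpace G]
  {E : Type*} [NormedAddCommGroup E]

/-- The pointwise norm of a compactly supported continuous function. -/
def ccNorm {G : Type*} [TopologicalSpace G] (u : C_c(G, E)) : C_c(G, ℝ) where
  toFun x := ‖u x‖
  continuous_toFun := u.continuous.norm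
  hasCompactSupport' := u.hasCompactSupport.norm

@[simp] lemma ccNorm_apply {G : Type*} [TopologicalSpace G] (u : C_c(G, E)) (x : G) :
    ccNorm u x = ‖u x‖ := rfl

variable {μ : Measure G} (p : ℝ≥0∞)

lemma memLp_cc [IsFiniteMeasureOnCompacts μ] (u : C_c(G, E)) : MemLp u p μ :=
  u.continuous.memLp_of_hasCompactSupport u.hasCompactSupport

/-- The class in `Lp` of a compactly supported continuous function. -/
def ccLp (μ : Measure G) [IsFiniteMeasureOnCompacts μ] : C_c(G, E) →+ Lp E p μ where
  toFun u := (memLp_cc p u).toLp u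
  map_zero' := rfl
  map_add' _ _ := rfl

lemma coeFn_ccLp [IsFiniteMeasureOnCompacts μ] (u : C_c(G, E)) : ccLp p μ u =ᵐ[μ] u :=
  (memLp_cc p u).coeFn_toLp

/-- Density of compactly supported continuous functions in `Lp`, on locally compact spaces that
need not be normal. -/
lemma exists_cc_eLpNorm_sub_le [T2Space G] [LocallyCompactSpace G] [μ.Regular] [NormedSpace ℝ E]
    {p : ℝ≥0∞} (hp : p ≠ ∞) {f : G → E} (hf : MemLp f p μ) {ε : ℝ≥0∞} (hε : ε ≠ 0) :
    ∃ u : C_c(G, E), eLpNorm (f - ⇑u) p μ ≤ ε := by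
  have key := hf.induction_dense hp (fun g => ∃ u : C_c(G, E), ⇑u = g) ?_ ?_ ?_ hε
  · obtain ⟨g, hg, u, rfl⟩ := key
    exact ⟨u, hg⟩
  · intro c t ht htμ ε hε
    -- A Urysohn function between a compact `K ⊆ t` and an open `U ⊇ t` approximates `1_t`.
    obtain ⟨η, ηpos, hη⟩ :
        ∃ η : ℝ≥0, 0 < η ∧ ∀ s : Set G, μ s ≤ η → eLpNorm (s.indicator fun _x => c) p μ ≤ ε :=
      exists_eLpNorm_indicator_le hp c hε
    have hη2 : (η : ℝ≥0∞) / 2 ≠ 0 := by simpa using ηpos.ne'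
    obtain ⟨K, hKt, hK, hKμ⟩ := ht.exists_isCompact_sdiff_lt htμ.ne hη2
    obtain ⟨U, htU, hU, -, hUμ⟩ := ht.exists_isOpen_sdiff_lt htμ.ne hη2
    obtain ⟨φ, hφ1, hφ0, hφc, hφ⟩ := exists_continuous_one_zero_of_isCompact hK hU.isClosed_compl
      (Set.disjoint_compl_right_iff_subset.2 (hKt.trans htU))
    refine ⟨fun x => φ x • c, ?_, ⟨⟨⟨fun x => φ x • c, by fun_prop⟩, hφc.smul_right⟩, rfl⟩⟩
    refine (eLpNorm_mono (g := (U \ K).indicator fun _ => c) fun x => ?_).trans (hη _ ?_)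
    · by_cases hxK : x ∈ K
      · simp [hφ1 hxK, hKt hxK, hxK]
      by_cases hxU : x ∈ U
      · have h1 := hφ x
        have e : φ x • c - t.indicator (fun _ => c) x = (φ x - t.indicator (fun _ => 1) x) • c := by
          by_cases hxt : x ∈ t <;> simp [hxt, sub_smul]
        simp only [Pi.sub_apply, e, norm_smul,
          Set.indicator_of_mem (show x ∈ U \ K from ⟨hxU, hxK⟩)]
        refine mul_le_of_le_one_left (norm_nonneg _) ?_
        rw [Real.norm_eq_abs, abs_le]
        by_cases hxt : x ∈ t <;> simp only [hxt, Set.indicator_of_mem, Set.indicator_of_notMem,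
          not_false_iff] <;> constructor <;> linarith [h1.1, h1.2]
      · have : x ∉ t := fun h => hxU (htU h)
        simp [hφ0 hxU, hxU, this]
    · have : U \ K ⊆ (U \ t) ∪ (t \ K) := fun x hx => by
        by_cases hxt : x ∈ t
        · exact Or.inr ⟨hxt, hx.2⟩
        · exact Or.inl ⟨hx.1, hxt⟩
      refine (measure_mono this).trans ((measure_union_le _ _).trans ?_)
      calc _ ≤ (η : ℝ≥0∞) / 2 + η / 2 := add_le_add hUμ.le hKμ.le
        _ = η := ENNReal.add_halves _
  · rintro _ _ ⟨u, rfl⟩ ⟨v, rfl⟩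
    exact ⟨u + v, rfl⟩
  · rintro _ ⟨u, rfl⟩
    exact (memLp_cc p u).1

variable {p}

lemma norm_ccLp_ccNorm [IsFiniteMeasureOnCompacts μ] (u : C_c(G, E)) :
    ‖ccLp p μ (ccNorm u)‖ = ‖ccLp p μ u‖ := by
  simp only [Lp.norm_def]
  rw [eLpNorm_congr_ae (coeFn_ccLp p (μ := μ) u),
    eLpNorm_congr_ae (coeFn_ccLp p (μ := μ) (ccNorm u))]
  congr 1
  exact eLpNorm_norm (u : G → E)

variable [Fact (1 ≤ p)]

/-- Every element of `Lp` is the sum of a norm convergent series of compactly supported continuous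
functions, and this series converges almost everywhere. -/
lemma exists_series_cc [T2Space G] [LocallyCompactSpace G] [μ.Regular] [NormedSpace ℝ E]
    [CompleteSpace E] (hp : p ≠ ∞) (f : Lp E p μ) :
    ∃ u : ℕ → C_c(G, E), (Summable fun n => ‖ccLp p μ (u n)‖) ∧
      HasSum (fun n => ccLp p μ (u n)) f ∧ ∀ᵐ x ∂μ, HasSum (fun n => u n x) (f x) := by
  have hd : f ∈ closure ((ccLp p μ : C_c(G, E) →+ Lp E p μ).range : Set (Lp E p μ)) := by
    rw [EMetric.mem_closure_iff]
    intro ε hε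
    obtain ⟨δ, hδ, hδε⟩ := exists_between hε
    obtain ⟨g, hfg⟩ := exists_cc_eLpNorm_sub_le hp (Lp.memLp f) hδ.ne'
    refine ⟨_, ⟨g, rfl⟩, ?_⟩
    rw [Lp.edist_def]
    refine lt_of_le_of_lt (le_trans (le_of_eq (eLpNorm_congr_ae ?_)) hfg) hδε
    filter_upwards [coeFn_ccLp p (μ := μ) g] with x hx
    simp only [Pi.sub_apply, hx]
  -- The norms decay geometrically, except possibly that of the first term.
  obtain ⟨v, hu, hv, -, hb⟩ := controlled_sum_of_mem_closure hd
    (b := fun n => (1 / 2 : ℝ) ^ n) (fun n => by positivity)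
  choose u huv using fun n => AddMonoidHom.mem_range.1 (hv n)
  simp only [← huv] at hu hb
  have hs : Summable fun n => ‖ccLp p μ (u n)‖ := by
    rw [← summable_nat_add_iff 1]
    refine Summable.of_nonneg_of_le (fun n => norm_nonneg _)
      (fun n => (hb (n + 1) (Nat.succ_pos n)).le)
      ((summable_nat_add_iff 1).2 summable_geometric_two)
  have hsum : HasSum (fun n => ccLp p μ (u n)) f := by
    have h1 := hs.of_norm.hasSum
    have h2 := (h1.tendsto_sum_nat.comp (tendsto_add_atTop_nat 1))
    rwa [tendsto_nhds_unique h2 hu] at h1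
  refine ⟨u, hs, hsum, ?_⟩
  have h3 := Lp.hasSum_coeFn_tsum (f := fun n => ccLp p μ (u n))
    (tsum_enorm_ne_top_iff_summable_norm.2 hs)
  rw [hsum.tsum_eq] at h3
  filter_upwards [h3, ae_all_iff.2 fun n => coeFn_ccLp p (μ := μ) (u n)] with x h4 h5
  simpa only [h5] using h4

end CompactSupport

/-! ### The modular function and inversion -/

section Inversion

variable {G : Type*} [Group G] [TopologicalSpace G] [IsTopologicalGroup G] [LocallyCompactSpace G]

lemma Δ_pos (x : G) : 0 < Δ x := by
  simpa [Δ] using Measure.modularCharacterFun_pos x⁻¹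

variable [MeasurableSpace G] [BorelSpace G] (μ : Measure G) [μ.IsHaarMeasure]

lemma integral_mul_right_eq_Δ_mul {g : G → ℝ} (hg : Continuous g) (hgc : HasCompactSupport g)
    (y : G) : ∫ z, g (z * y) ∂μ = Δ y⁻¹ * ∫ z, g z ∂μ := by
  have h1 := Measure.integral_isMulLeftInvariant_eq_smul_of_hasCompactSupport
    (μ.map (fun z => z * y)) μ hg hgc
  rw [integral_map (by fun_prop)
    (hg.stronglyMeasurable_of_hasCompactSupport hgc).aestronglyMeasurable,
    ← Measure.modularCharacterFun_eq_haarScalarFactor μ y, integral_smul_nnreal_measure] at h1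
  rw [h1, Δ, inv_inv]
  rfl

omit [LocallyCompactSpace G] [μ.IsHaarMeasure] in
lemma integral_inv_measure {E : Type*} [NormedAddCommGroup E] [NormedSpace ℝ E] (g : G → E) :
    ∫ z, g z ∂μ.inv = ∫ z, g z⁻¹ ∂μ :=
  integral_map_equiv (MeasurableEquiv.inv G) g

lemma integral_inv_mul_inv_measure {g : G → ℝ} (hg : Continuous g) (hgc : HasCompactSupport g)
    (y : G) : ∫ z, g (z⁻¹ * y) ∂μ.inv = Δ y⁻¹ * ∫ z, g z ∂μ := by
  rw [integral_inv_measure, ← integral_mul_right_eq_Δ_mul μ hg hgc]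
  simp

/-- By right translation of a fixed compactly supported function, `Δ(y⁻¹)` is a ratio of integrals
that depends continuously on `y`. -/
lemma continuous_Δ_inv : Continuous fun y : G => Δ y⁻¹ := by
  borelize G
  obtain ⟨⟨g, hg⟩, hgc, hg0, hg1⟩ := exists_continuous_nonneg_pos (1 : G)
  let ν : Measure G := Measure.haar
  have hI : 0 < ∫ z, g z ∂ν := hg.integral_pos_of_hasCompactSupport_nonneg_nonzero hgc hg0 hg1
  have h1 := continuous_integral_apply_inv_mul (μ := ν.inv) hg hgc
  simp only [integral_inv_mul_inv_measure ν hg hgc] at h1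
  convert h1.div_const (∫ z, g z ∂ν) using 2 with y
  field_simp

/-- The inversion formula `∫ f(y⁻¹) Δ(y⁻¹) dy = ∫ f(y) dy` for compactly supported functions:
compare `μ` with the right invariant measure `μ.inv` by means of the general formula relating a left
and a right invariant measure. -/
lemma integral_Δ_inv_mul_of_hasCompactSupport {f : G → ℝ} (hf : Continuous f)
    (hfc : HasCompactSupport f) : ∫ y, Δ y⁻¹ * f y⁻¹ ∂μ = ∫ y, f y ∂μ := by
  obtain ⟨⟨g, hg⟩, hgc, hg0, hg1⟩ := exists_continuous_nonneg_pos (1 : G)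
  have hI : 0 < ∫ z, g z ∂μ := hg.integral_pos_of_hasCompactSupport_nonneg_nonzero hgc hg0 hg1
  have h1 := Measure.integral_isMulLeftInvariant_isMulRightInvariant_combo (μ := μ) (ν := μ.inv)
    hf hfc hg hgc hg0 hg1
  rw [h1, integral_inv_measure, ← integral_mul_const]
  refine integral_congr_ae (Eventually.of_forall fun y => ?_)
  have e : Δ y⁻¹ = (Δ y)⁻¹ := by
    have : Measure.modularCharacterFun (y⁻¹) * Measure.modularCharacterFun y = 1 := by
      rw [← Measure.modularCharacterFun_map_mul, inv_mul_cancel,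
        Measure.modularCharacterFun_map_one]
    rw [Δ, Δ, inv_inv, eq_inv_of_mul_eq_one_left this]
    simp
  have h2 := Δ_pos y
  simp only [ContinuousMap.coe_mk] at *
  rw [integral_inv_mul_inv_measure μ hg hgc, inv_inv, e]
  field_simp

variable [μ.Regular]

variable [T2Space G]

/-- Inversion preserves null sets.  No countability assumption is made on `G`, so this uses the
regularity of `μ`: an open set `V` on which `Δ(x⁻¹) > 1/(k+1)` satisfies `μ V ≤ (k+1) μ(V⁻¹)`. -/
lemma quasiMeasurePreserving_inv : Measure.QuasiMeasurePreserving (fun x : G => x⁻¹) μ μ := by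
  refine ⟨measurable_inv, Measure.AbsolutelyContinuous.mk fun N hN h0 => ?_⟩
  rw [Measure.map_apply measurable_inv hN]
  have hV : ∀ (k : ℕ) (V : Set G), IsOpen V → (∀ x ∈ V, 1 / (k + 1 : ℝ) < Δ x⁻¹) →
      μ V⁻¹ < ∞ → μ V ≤ (k + 1 : ℕ) * μ V⁻¹ := by
    intro k V hVo hVk hfin
    rw [hVo.measure_eq_iSup_isCompact]
    refine iSup₂_le fun K hKV => iSup_le fun hK => ?_
    obtain ⟨φ, hφ1, hφ0, hφc, hφ⟩ := exists_continuous_one_zero_of_isCompact hK hVo.isClosed_compl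
      (Set.disjoint_compl_right_iff_subset.2 hKV)
    have hφi : Integrable φ μ := φ.continuous.integrable_of_hasCompactSupport hφc
    have hφi2 : Integrable (fun x => Δ x⁻¹ * φ x) μ :=
      ((continuous_Δ_inv).mul φ.continuous).integrable_of_hasCompactSupport hφc.mul_left
    have hic : HasCompactSupport fun x => φ x⁻¹ := hφc.comp_homeomorph (Homeomorph.inv G)
    have hφi3 : Integrable (fun x => φ x⁻¹) μ :=
      (φ.continuous.comp continuous_inv).integrable_of_hasCompactSupport hic
    have h1 : μ.real K ≤ ∫ x, φ x ∂μ := by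
      rw [← integral_indicator_one hK.measurableSet]
      refine integral_mono ((integrable_indicator_iff hK.measurableSet).2
        (integrableOn_const hK.measure_ne_top)) hφi fun x => ?_
      by_cases hx : x ∈ K
      · simp [hx, hφ1 hx]
      · simpa [hx] using (hφ x).1
    have h2 : ∫ x, φ x ∂μ ≤ (k + 1) * ∫ x, Δ x⁻¹ * φ x ∂μ := by
      rw [← integral_const_mul]
      refine integral_mono hφi (hφi2.const_mul _) fun x => ?_
      by_cases hx : x ∈ V
      · have h3 := hVk x hx
        rw [div_lt_iff₀ (by positivity)] at h3
        have h4 := (hφ x).1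
        simp only
        nlinarith
      · simp [hφ0 hx]
    have h3 : ∫ x, Δ x⁻¹ * φ x ∂μ = ∫ x, φ x⁻¹ ∂μ := by
      simpa using integral_Δ_inv_mul_of_hasCompactSupport μ (φ.continuous.comp continuous_inv) hic
    have h4 : ∫ x, φ x⁻¹ ∂μ ≤ μ.real V⁻¹ := by
      rw [← integral_indicator_one hVo.inv.measurableSet]
      refine integral_mono hφi3 ((integrable_indicator_iff hVo.inv.measurableSet).2
        (integrableOn_const hfin.ne)) fun x => ?_
      by_cases hx : x ∈ V⁻¹
      · simpa [hx] using (hφ x⁻¹).2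
      · simp [hx, hφ0 hx]
    have h5 : μ.real K ≤ (k + 1) * μ.real V⁻¹ := by
      refine h1.trans (h2.trans ?_)
      rw [h3]
      gcongr
    rw [← ENNReal.ofReal_toReal hK.measure_ne_top, ← ENNReal.ofReal_toReal hfin.ne,
      ← ENNReal.ofReal_natCast, ← ENNReal.ofReal_mul (by positivity)]
    refine ENNReal.ofReal_le_ofReal ?_
    push_cast
    exact h5
  have hk : ∀ k : ℕ, μ (N⁻¹ ∩ {x | 1 / (k + 1 : ℝ) < Δ x⁻¹}) = 0 := by
    intro k
    refine le_antisymm (ENNReal.le_of_forall_pos_le_add fun ε hε _ => ?_) bot_le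
    obtain ⟨U, hNU, hU, hUμ⟩ := N.exists_isOpen_lt_of_lt
      (μ := μ) (ε / (k + 1 : ℕ) : ℝ≥0∞) (by rw [h0]; simp [hε.ne'])
    have hO : IsOpen (U⁻¹ ∩ {x : G | 1 / (k + 1 : ℝ) < Δ x⁻¹}) :=
      hU.inv.inter (isOpen_lt continuous_const continuous_Δ_inv)
    have hsub : (U⁻¹ ∩ {x : G | 1 / (k + 1 : ℝ) < Δ x⁻¹})⁻¹ ⊆ U := fun x hx => by
      simpa using hx.1
    have hlt := (measure_mono (μ := μ) hsub).trans_lt hUμ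
    refine (measure_mono (Set.inter_subset_inter_left _ (Set.inv_subset_inv.2 hNU))).trans ?_
    refine (hV k _ hO (fun x hx => hx.2) (hlt.trans_le le_top)).trans ?_
    rw [zero_add]
    calc _ ≤ ((k + 1 : ℕ) : ℝ≥0∞) * (ε / (k + 1 : ℕ)) := by gcongr
      _ = ε := ENNReal.mul_div_cancel (by simp) (by simp)
  refine measure_mono_null (t := ⋃ k : ℕ, N⁻¹ ∩ {x | 1 / (k + 1 : ℝ) < Δ x⁻¹}) (fun x hx => ?_)
    (measure_iUnion_null hk)
  obtain ⟨k, hk⟩ := exists_nat_one_div_lt (Δ_pos x⁻¹)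
  exact Set.mem_iUnion.2 ⟨k, hx, hk⟩

variable {μ}

lemma ae_inv {P : G → Prop} (h : ∀ᵐ w ∂μ, P w) : ∀ᵐ y ∂μ, P y⁻¹ :=
  (quasiMeasurePreserving_inv μ).ae h

omit [LocallyCompactSpace G] [μ.Regular] [T2Space G] in
lemma ae_mul_left {P : G → Prop} (h : ∀ᵐ w ∂μ, P w) (x : G) : ∀ᵐ y ∂μ, P (x * y) :=
  (measurePreserving_mul_left μ x).quasiMeasurePreserving.ae h

lemma ae_inv_mul {P : G → Prop} (h : ∀ᵐ w ∂μ, P w) (x : G) : ∀ᵐ y ∂μ, P (y⁻¹ * x) := by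
  simpa using ae_mul_left (ae_inv h) x⁻¹

variable {E : Type*} [NormedAddCommGroup E] [NormedSpace ℝ E] [CompleteSpace E]

/-- The substitution `y ↦ y⁻¹`, with Jacobian `Δ(y⁻¹)`, for Bochner integrals. -/
lemma integrable_integral_Δ_inv_smul {g : G → E} (hg : Integrable g μ) :
    Integrable (fun y => Δ y⁻¹ • g y⁻¹) μ ∧ ∫ y, Δ y⁻¹ • g y⁻¹ ∂μ = ∫ y, g y ∂μ := by
  obtain ⟨u, hs, -, hu⟩ := exists_series_cc ENNReal.one_ne_top (hg.toL1 g)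
  have hu2 : ∀ᵐ x ∂μ, HasSum (fun n => u n x) (g x) := by
    filter_upwards [hu, hg.coeFn_toL1] with x h1 h2
    rwa [h2] at h1
  have hui : ∀ n, Integrable (u n) μ := fun n =>
    (u n).continuous.integrable_of_hasCompactSupport (u n).hasCompactSupport
  have hnorm : ∀ n, ‖ccLp 1 μ (u n)‖ = ∫ y, ‖u n y‖ ∂μ := fun n => by
    rw [L1.norm_eq_integral_norm]
    refine integral_congr_ae ?_
    filter_upwards [coeFn_ccLp 1 (μ := μ) (u n)] with y hy
    rw [hy]
  simp only [hnorm] at hs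
  have hJi : ∀ n, Integrable (fun y => Δ y⁻¹ • u n y⁻¹) μ := fun n =>
    (continuous_Δ_inv.smul ((u n).continuous.comp continuous_inv)).integrable_of_hasCompactSupport
      (((u n).hasCompactSupport.comp_homeomorph (Homeomorph.inv G)).smul_left)
  -- The substitution preserves the `L¹` norm of compactly supported functions, so it may be applied
  -- to the series term by term.
  have hJn : ∀ n, ∫ y, ‖Δ y⁻¹ • u n y⁻¹‖ ∂μ = ∫ y, ‖u n y‖ ∂μ := fun n => by
    rw [← integral_Δ_inv_mul_of_hasCompactSupport μ (map_continuous (u n)).norm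
      (u n).hasCompactSupport.norm]
    simp only [norm_smul, Real.norm_eq_abs, abs_of_pos (Δ_pos _)]
  have hJ : ∀ n, ∫ y, Δ y⁻¹ • u n y⁻¹ ∂μ = ∫ y, u n y ∂μ := fun n => by
    rw [SeparatingDual.eq_iff_forall_dual_eq (R := ℝ)]
    intro ℓ
    rw [← ContinuousLinearMap.integral_comp_comm _ (hJi n),
      ← ContinuousLinearMap.integral_comp_comm _ (hui n)]
    simpa using integral_Δ_inv_mul_of_hasCompactSupport μ
      (ℓ.continuous.comp (map_continuous (u n))) ((u n).hasCompactSupport.comp_left (map_zero ℓ))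
  have h1 := integrable_of_hasSum hui hs hu2
  have h2 := integrable_of_hasSum (K := fun y => Δ y⁻¹ • g y⁻¹) hJi (by simpa only [hJn] using hs)
    ((ae_inv hu2).mono fun y hy => hy.const_smul _)
  refine ⟨h2.1, h2.2.unique ?_⟩
  simpa only [hJ] using h1.2

end Inversion

/-! ### Convolution along a pairing that varies with the point -/

lemma aestronglyMeasurable_of_hasSum {X : Type*} [MeasurableSpace X] {μ : Measure X} {E : Type*}
    [NormedAddCommGroup E] {F : ℕ → X → E} {K : X → E} (hF : ∀ n, AEStronglyMeasurable (F n) μ)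
    (hK : ∀ᵐ y ∂μ, HasSum (fun n => F n y) (K y)) : AEStronglyMeasurable K μ :=
  aestronglyMeasurable_of_tendsto_ae atTop
    (fun n : ℕ => Finset.aestronglyMeasurable_fun_sum (Finset.range n) fun i _ => hF i)
    (hK.mono fun _ hy => hy.tendsto_sum_nat)

/-- A family of contractive bilinear maps `E × F → W`, indexed continuously by the points of `G`. -/
structure Pairing (G E F W : Type*) [TopologicalSpace G] [NormedAddCommGroup E] [NormedSpace ℝ E]
    [NormedAddCommGroup F] [NormedSpace ℝ F] [NormedAddCommGroup W] [NormedSpace ℝ W] where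
  /-- The bilinear map at a point. -/
  toFun : G → E →L[ℝ] F →L[ℝ] W
  continuous_toFun : Continuous fun q : G × E × F => toFun q.1 q.2.1 q.2.2
  norm_le : ∀ w u v, ‖toFun w u v‖ ≤ ‖u‖ * ‖v‖

namespace Pairing

instance {G E F W : Type*} [TopologicalSpace G] [NormedAddCommGroup E] [NormedSpace ℝ E]
    [NormedAddCommGroup F] [NormedSpace ℝ F] [NormedAddCommGroup W] [NormedSpace ℝ W] :
    CoeFun (Pairing G E F W) fun _ => G → E →L[ℝ] F →L[ℝ] W := ⟨toFun⟩

/-- The multiplication of `ℝ`, as a constant pairing. -/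
def realMul (G : Type*) [TopologicalSpace G] : Pairing G ℝ ℝ ℝ where
  toFun _ := ContinuousLinearMap.mul ℝ ℝ
  continuous_toFun := by simp only [ContinuousLinearMap.mul_apply']; fun_prop
  norm_le _ u v := by simp

@[simp] lemma realMul_apply {G : Type*} [TopologicalSpace G] (w : G) (u v : ℝ) :
    realMul G w u v = u * v := rfl

variable {G : Type*} [Group G] [TopologicalSpace G] [IsTopologicalGroup G] [LocallyCompactSpace G]
  [T2Space G] [MeasurableSpace G] [BorelSpace G] {μ : Measure G} [μ.IsHaarMeasure] [μ.Regular]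
  {E F W : Type*} [NormedAddCommGroup E] [NormedSpace ℝ E] [CompleteSpace E]
  [NormedAddCommGroup F] [NormedSpace ℝ F] [CompleteSpace F]
  [NormedAddCommGroup W] [NormedSpace ℝ W] [CompleteSpace W]
  (B : Pairing G E F W) {p : ℝ≥0∞} [Fact (1 ≤ p)] (hp : p ≠ ∞)

include hp in
omit [CompleteSpace E] [CompleteSpace W] [μ.IsHaarMeasure] in
/-- Measurability is the point here: when `G` is not second countable, `w ↦ B w u (g w)` need not be
the composite of a continuous map with a strongly measurable one, so `g` is expanded into a series
of compactly supported continuous functions. -/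
lemma memLp_apply (u : E) (g : Lp F p μ) : MemLp (fun w => B w u (g w)) p μ := by
  obtain ⟨v, -, -, hv⟩ := exists_series_cc hp g
  refine (Lp.memLp g).of_le_mul (c := ‖u‖) (aestronglyMeasurable_of_hasSum (fun n => ?_)
    (hv.mono fun w hw => (B w u).hasSum hw)) (Eventually.of_forall fun w => B.norm_le w u _)
  have hc : Continuous fun w => B w u (v n w) :=
    B.continuous_toFun.comp (continuous_id.prodMk (continuous_const.prodMk (map_continuous (v n))))
  refine (hc.stronglyMeasurable_of_hasCompactSupport ?_).aestronglyMeasurable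
  exact HasCompactSupport.intro (v n).hasCompactSupport fun w hw => by
    rw [image_eq_zero_of_notMem_tsupport hw, map_zero]

/-- The operator `g ↦ (w ↦ B w u (g w))` from `Lp F` to `Lp W`. -/
def mulLp : E →L[ℝ] Lp F p μ →L[ℝ] Lp W p μ :=
  LinearMap.mkContinuous₂
    (LinearMap.mk₂ ℝ (fun u g => (B.memLp_apply hp u g).toLp _)
      (fun u v g => by
        apply Lp.ext
        filter_upwards [(B.memLp_apply hp (u + v) g).coeFn_toLp, (B.memLp_apply hp u g).coeFn_toLp,
          (B.memLp_apply hp v g).coeFn_toLp, Lp.coeFn_add ((B.memLp_apply hp u g).toLp _)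
            ((B.memLp_apply hp v g).toLp _)] with x h1 h2 h3 h4
        rw [h4, h1, Pi.add_apply, h2, h3]
        simp)
      (fun c u g => by
        apply Lp.ext
        filter_upwards [(B.memLp_apply hp (c • u) g).coeFn_toLp, (B.memLp_apply hp u g).coeFn_toLp,
          Lp.coeFn_smul c ((B.memLp_apply hp u g).toLp _)] with x h1 h2 h4
        rw [h4, h1, Pi.smul_apply, h2]
        simp)
      (fun u f g => by
        apply Lp.ext
        filter_upwards [(B.memLp_apply hp u (f + g)).coeFn_toLp, (B.memLp_apply hp u f).coeFn_toLp,
          (B.memLp_apply hp u g).coeFn_toLp, Lp.coeFn_add f g,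
          Lp.coeFn_add ((B.memLp_apply hp u f).toLp _) ((B.memLp_apply hp u g).toLp _)]
          with x h1 h2 h3 h5 h4
        rw [h4, h1, Pi.add_apply, h2, h3, h5]
        simp)
      (fun c u f => by
        apply Lp.ext
        filter_upwards [(B.memLp_apply hp u (c • f)).coeFn_toLp, (B.memLp_apply hp u f).coeFn_toLp,
          Lp.coeFn_smul c f, Lp.coeFn_smul c ((B.memLp_apply hp u f).toLp _)] with x h1 h2 h3 h4
        rw [h4, h1, Pi.smul_apply, h2, h3]
        simp))
    1 (fun u g => by
      rw [one_mul]
      refine Lp.norm_le_mul_norm_of_ae_le_mul (f := (B.memLp_apply hp u g).toLp _) (g := g) ?_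
      filter_upwards [(B.memLp_apply hp u g).coeFn_toLp] with x h1
      rw [h1]
      exact B.norm_le _ _ _)

omit [CompleteSpace E] [CompleteSpace W] [μ.IsHaarMeasure] in
lemma coeFn_mulLp (u : E) (g : Lp F p μ) : B.mulLp hp u g =ᵐ[μ] fun w => B w u (g w) :=
  (B.memLp_apply hp u g).coeFn_toLp

omit [CompleteSpace E] [CompleteSpace W] [μ.IsHaarMeasure] in
lemma norm_mulLp_le (u : E) (g : Lp F p μ) : ‖B.mulLp hp u g‖ ≤ ‖u‖ * ‖g‖ := by
  refine Lp.norm_le_mul_norm_of_ae_le_mul ?_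
  filter_upwards [B.coeFn_mulLp hp u g] with x h1
  rw [h1]
  exact B.norm_le _ _ _

end Pairing

section Translation

variable {G : Type*} [Group G] [TopologicalSpace G] [IsTopologicalGroup G]
  [MeasurableSpace G] [BorelSpace G] (μ : Measure G) [μ.IsHaarMeasure]
  {W : Type*} [NormedAddCommGroup W] [NormedSpace ℝ W] {p : ℝ≥0∞} [Fact (1 ≤ p)]

/-- Left translation on `Lp`. -/
def transLp (y : G) : Lp W p μ →ₗᵢ[ℝ] Lp W p μ :=
  Lp.compMeasurePreservingₗᵢ ℝ (fun x => y⁻¹ * x) (measurePreserving_mul_left μ y⁻¹)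

variable {μ}

lemma coeFn_transLp (y : G) (g : Lp W p μ) : transLp μ y g =ᵐ[μ] fun x => g (y⁻¹ * x) :=
  Lp.coeFn_compMeasurePreserving g (measurePreserving_mul_left μ y⁻¹)

lemma continuous_transLp [LocallyCompactSpace G] [T2Space G] [μ.Regular] (hp : p ≠ ∞)
    {g : G → Lp W p μ} (hg : Continuous g) : Continuous fun y => transLp μ y (g y) := by
  have hc : Continuous fun y : G => (⟨fun x => y⁻¹ * x, by fun_prop⟩ : C(G, G)) :=
    ContinuousMap.continuous_of_continuous_uncurry _ (by
      simp only [Function.uncurry_def, ContinuousMap.coe_mk]; fun_prop)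
  exact hg.compMeasurePreservingLp hc (fun y => measurePreserving_mul_left μ y⁻¹) hp

end Translation

section SetIntegral

variable {X : Type*} [MeasurableSpace X] {μ : Measure X}
  {W : Type*} [NormedAddCommGroup W] [NormedSpace ℝ W] {p : ℝ≥0∞} [hp1 : Fact (1 ≤ p)]

/-- Integration over a set of finite measure, as a bounded functional on `Lp`. -/
def setIntegralLp (s : Set X) (hs : μ s ≠ ∞) : Lp W p μ →L[ℝ] W :=
  LinearMap.mkContinuous
    { toFun := fun g => ∫ x in s, g x ∂μ
      map_add' := fun f g => by
        rw [← integral_add (integrableOn_Lp_of_measure_ne_top f hp1.out hs)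
          (integrableOn_Lp_of_measure_ne_top g hp1.out hs)]
        exact integral_congr_ae (ae_restrict_of_ae (Lp.coeFn_add f g))
      map_smul' := fun c f => by
        rw [RingHom.id_apply, ← integral_smul]
        exact integral_congr_ae (ae_restrict_of_ae (Lp.coeFn_smul c f)) }
    (μ s ^ (1 - 1 / p.toReal)).toReal (fun g => by
      refine (norm_integral_le_integral_norm _).trans ?_
      rw [integral_norm_eq_lintegral_enorm (Lp.aestronglyMeasurable g).restrict,
        ← eLpNorm_one_eq_lintegral_enorm, Lp.norm_def, ← ENNReal.toReal_mul, mul_comm]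
      have h1 := eLpNorm_le_eLpNorm_mul_rpow_measure_univ hp1.out
        (Lp.aestronglyMeasurable g).restrict (μ := μ.restrict s)
      simp only [ENNReal.toReal_one, div_one, Measure.restrict_apply_univ] at h1
      refine ENNReal.toReal_mono ?_ (h1.trans ?_)
      · refine ENNReal.mul_ne_top (Lp.eLpNorm_ne_top g) ?_
        refine ENNReal.rpow_ne_top_of_nonneg (sub_nonneg.2 ?_) hs
        rcases eq_or_ne p ∞ with rfl | hp
        · simp
        rw [div_le_one (ENNReal.toReal_pos (zero_lt_one.trans_le hp1.out).ne' hp)]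
        simpa using ENNReal.toReal_mono hp hp1.out
      · gcongr
        exact Measure.restrict_le_self)

lemma setIntegralLp_apply (s : Set X) (hs : μ s ≠ ∞) (g : Lp W p μ) :
    setIntegralLp s hs g = ∫ x in s, g x ∂μ := rfl

end SetIntegral

/-! ### The pointwise formula for vector valued convolutions -/

section Step

variable {G : Type*} [MeasurableSpace G] {μ : Measure G}
  {W : Type*} [NormedAddCommGroup W] [NormedSpace ℝ W] [CompleteSpace W]
  {p : ℝ≥0∞} [Fact (1 ≤ p)]

/-- If kernels `K n` represent the elements `J n` of `Lp`, and their absolute integrals are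
dominated by a summable series in `Lp`, then the sum of the kernels represents the sum of the
`J n`. -/
lemma ae_integral_eq_of_hasSum {K : ℕ → G → G → W} {J : ℕ → Lp W p μ} {N : ℕ → Lp ℝ p μ}
    {k : G → G → W} {j : Lp W p μ}
    (hK : ∀ n, ∀ᵐ x ∂μ, Integrable (K n x) μ ∧ ∫ y, K n x y ∂μ = J n x)
    (hN : ∀ n, ∀ᵐ x ∂μ, ∫ y, ‖K n x y‖ ∂μ ≤ N n x)
    (hNs : Summable fun n => ‖N n‖) (hJs : Summable fun n => ‖J n‖) (hJ : HasSum J j)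
    (hk : ∀ᵐ x ∂μ, ∀ᵐ y ∂μ, HasSum (fun n => K n x y) (k x y)) :
    ∀ᵐ x ∂μ, Integrable (k x) μ ∧ ∫ y, k x y ∂μ = j x := by
  have h1 := Lp.hasSum_coeFn_tsum (tsum_enorm_ne_top_iff_summable_norm.2 hNs)
  have h2 := Lp.hasSum_coeFn_tsum (tsum_enorm_ne_top_iff_summable_norm.2 hJs)
  rw [hJ.tsum_eq] at h2
  filter_upwards [ae_all_iff.2 hK, ae_all_iff.2 hN, h1, h2, hk] with x h3 h4 h5 h6 h7
  have h8 := integrable_of_hasSum (fun n => (h3 n).1)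
    (Summable.of_nonneg_of_le (fun n => integral_nonneg fun y => norm_nonneg _) h4 h5.summable) h7
  refine ⟨h8.1, h8.2.unique ?_⟩
  simpa only [(h3 _).2] using h6

end Step

namespace Pairing

variable {G : Type*} [Group G] [TopologicalSpace G] [IsTopologicalGroup G] [LocallyCompactSpace G]
  [T2Space G] [MeasurableSpace G] [BorelSpace G] {μ : Measure G} [μ.IsHaarMeasure] [μ.Regular]
  {E F W : Type*} [NormedAddCommGroup E] [NormedSpace ℝ E] [CompleteSpace E]
  [NormedAddCommGroup F] [NormedSpace ℝ F] [CompleteSpace F]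
  [NormedAddCommGroup W] [NormedSpace ℝ W] [CompleteSpace W]
  (B : Pairing G E F W) {p : ℝ≥0∞} [Fact (1 ≤ p)] (hp : p ≠ ∞)

/-- The `Lp`-valued function `y ↦ λ(y) (w ↦ B w (h y) (f w))`. -/
def convIntegrand (h : G → E) (f : Lp F p μ) (y : G) : Lp W p μ :=
  transLp μ y (B.mulLp hp (h y) f)

omit [CompleteSpace E] [CompleteSpace W] in
lemma coeFn_convIntegrand (h : G → E) (f : Lp F p μ) (y : G) :
    B.convIntegrand hp h f y =ᵐ[μ] fun x => B (y⁻¹ * x) (h y) (f (y⁻¹ * x)) := by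
  filter_upwards [coeFn_transLp y (B.mulLp hp (h y) f),
    ae_mul_left (B.coeFn_mulLp hp (h y) f) y⁻¹] with x h1 h2
  rw [convIntegrand, h1, h2]

omit [CompleteSpace E] [CompleteSpace W] in
lemma norm_convIntegrand_le (h : G → E) (f : Lp F p μ) (y : G) :
    ‖B.convIntegrand hp h f y‖ ≤ ‖h y‖ * ‖f‖ := by
  rw [convIntegrand, LinearIsometry.norm_map]
  exact B.norm_mulLp_le hp _ _

omit [CompleteSpace E] [CompleteSpace W] in
lemma hasSum_convIntegrand_left {h : ℕ → G → E} {k : G → E} (f : Lp F p μ) {y : G}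
    (hs : HasSum (fun n => h n y) (k y)) :
    HasSum (fun n => B.convIntegrand hp (h n) f y) (B.convIntegrand hp k f y) :=
  (transLp μ y).toContinuousLinearMap.hasSum (((B.mulLp hp).flip f).hasSum hs)

omit [CompleteSpace E] [CompleteSpace W] in
lemma hasSum_convIntegrand_right (h : G → E) {f : ℕ → Lp F p μ} {g : Lp F p μ} {y : G}
    (hs : HasSum f g) :
    HasSum (fun n => B.convIntegrand hp h (f n) y) (B.convIntegrand hp h g y) :=
  (transLp μ y).toContinuousLinearMap.hasSum ((B.mulLp hp (h y)).hasSum hs)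

omit [CompleteSpace W] in
lemma integrable_convIntegrand (h : Lp E 1 μ) (f : Lp F p μ) :
    Integrable (B.convIntegrand hp h f) μ := by
  obtain ⟨u, -, -, hu⟩ := exists_series_cc ENNReal.one_ne_top h
  refine ((L1.integrable_coeFn h).norm.mul_const ‖f‖).mono'
    (aestronglyMeasurable_of_hasSum (fun n => ?_)
      (hu.mono fun y hy => B.hasSum_convIntegrand_left hp f hy))
    (Eventually.of_forall fun y => B.norm_convIntegrand_le hp _ _ _)
  have hc : Continuous (B.convIntegrand hp (u n) f) :=
    continuous_transLp hp (((B.mulLp hp).flip f).continuous.comp (map_continuous (u n)))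
  refine (hc.stronglyMeasurable_of_hasCompactSupport ?_).aestronglyMeasurable
  exact HasCompactSupport.intro (u n).hasCompactSupport fun y hy => by
    simp [convIntegrand, image_eq_zero_of_notMem_tsupport hy]

/-- The convolution `∫ λ(y) (w ↦ B w (h y) (f w)) dy` of `h ∈ L¹` and `f ∈ Lp`, as a Bochner
integral in `Lp`. -/
def convLp (h : Lp E 1 μ) (f : Lp F p μ) : Lp W p μ := ∫ y, B.convIntegrand hp h f y ∂μ

omit [CompleteSpace W] in
lemma integral_norm_convIntegrand_le (h : Lp E 1 μ) (f : Lp F p μ) :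
    ∫ y, ‖B.convIntegrand hp h f y‖ ∂μ ≤ ‖h‖ * ‖f‖ := by
  rw [L1.norm_eq_integral_norm, ← integral_mul_const]
  exact integral_mono (B.integrable_convIntegrand hp h f).norm
    ((L1.integrable_coeFn h).norm.mul_const _) fun y => B.norm_convIntegrand_le hp _ _ _

omit [CompleteSpace W] in
lemma norm_convLp_le (h : Lp E 1 μ) (f : Lp F p μ) : ‖B.convLp hp h f‖ ≤ ‖h‖ * ‖f‖ :=
  (norm_integral_le_integral_norm _).trans (B.integral_norm_convIntegrand_le hp h f)

lemma hasSum_convLp_left {h : ℕ → Lp E 1 μ} {k : Lp E 1 μ} (hs : Summable fun n => ‖h n‖)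
    (hk : HasSum h k) (f : Lp F p μ) :
    HasSum (fun n => B.convLp hp (h n) f) (B.convLp hp k f) := by
  have h1 := Lp.hasSum_coeFn_tsum (tsum_enorm_ne_top_iff_summable_norm.2 hs)
  rw [hk.tsum_eq] at h1
  exact (integrable_of_hasSum (fun n => B.integrable_convIntegrand hp (h n) f)
    (Summable.of_nonneg_of_le (fun _ => integral_nonneg fun _ => norm_nonneg _)
      (fun _ => B.integral_norm_convIntegrand_le hp _ _) (hs.mul_right _))
    (h1.mono fun y hy => B.hasSum_convIntegrand_left hp f hy)).2

lemma hasSum_convLp_right (h : Lp E 1 μ) {f : ℕ → Lp F p μ} {g : Lp F p μ}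
    (hs : Summable fun n => ‖f n‖) (hg : HasSum f g) :
    HasSum (fun n => B.convLp hp h (f n)) (B.convLp hp h g) :=
  (integrable_of_hasSum (fun n => B.integrable_convIntegrand hp h (f n))
    (Summable.of_nonneg_of_le (fun _ => integral_nonneg fun _ => norm_nonneg _)
      (fun _ => B.integral_norm_convIntegrand_le hp _ _) (hs.mul_left _))
    (Eventually.of_forall fun _ => B.hasSum_convIntegrand_right hp h hg)).2

open scoped Pointwise

section CompactSupport

variable (u : C_c(G, E)) (v : C_c(G, F))

omit [LocallyCompactSpace G] [CompleteSpace E] [CompleteSpace F] [CompleteSpace W]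

set_option linter.unusedSectionVars false

lemma continuous_kernel :
    Continuous fun q : G × G => B (q.2⁻¹ * q.1) (u q.2) (v (q.2⁻¹ * q.1)) :=
  B.continuous_toFun.comp (by
    have := map_continuous u
    have := map_continuous v
    fun_prop : Continuous fun q : G × G => (q.2⁻¹ * q.1, u q.2, v (q.2⁻¹ * q.1)))

variable {u v} in
lemma kernel_eq_zero {x y : G} (h : ¬ (y ∈ tsupport u ∧ y⁻¹ * x ∈ tsupport v)) :
    B (y⁻¹ * x) (u y) (v (y⁻¹ * x)) = 0 := by
  rcases not_and_or.1 h with h | h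
  · simp [image_eq_zero_of_notMem_tsupport h]
  · simp [image_eq_zero_of_notMem_tsupport h]

lemma hasCompactSupport_kernel (x : G) :
    HasCompactSupport fun y => B (y⁻¹ * x) (u y) (v (y⁻¹ * x)) :=
  HasCompactSupport.intro u.hasCompactSupport fun _ hy => B.kernel_eq_zero fun h => hy h.1

lemma integrable_kernel (μ : Measure G)
    [IsFiniteMeasureOnCompacts μ] (x : G) :
    Integrable (fun y => B (y⁻¹ * x) (u y) (v (y⁻¹ * x))) μ :=
  ((B.continuous_kernel u v).comp (by fun_prop : Continuous fun y => (x, y))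
    ).integrable_of_hasCompactSupport (B.hasCompactSupport_kernel u v x)

/-- The convolution of compactly supported continuous functions. -/
def ccConv (μ : Measure G)
    [IsFiniteMeasureOnCompacts μ] : C_c(G, W) where
  toFun x := ∫ y, B (y⁻¹ * x) (u y) (v (y⁻¹ * x)) ∂μ
  continuous_toFun := by
    rw [← continuousOn_univ]
    exact continuousOn_integral_of_compact_support u.hasCompactSupport
      (B.continuous_kernel u v).continuousOn
      fun x y _ hy => B.kernel_eq_zero fun h => hy h.1
  hasCompactSupport' := by
    refine HasCompactSupport.intro (K := tsupport u * tsupport v)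
      (u.hasCompactSupport.mul v.hasCompactSupport) fun x hx => ?_
    refine integral_eq_zero_of_ae (Eventually.of_forall fun y => B.kernel_eq_zero fun h => hx ?_)
    simpa using Set.mul_mem_mul h.1 h.2

lemma ccConv_apply (μ : Measure G)
    [IsFiniteMeasureOnCompacts μ] (x : G) :
    B.ccConv u v μ x = ∫ y, B (y⁻¹ * x) (u y) (v (y⁻¹ * x)) ∂μ := rfl

end CompactSupport

/-- For compactly supported continuous functions, the Bochner integral in `Lp` is the class of the
pointwise integral: integrate over sets of finite measure and apply Fubini's theorem. -/
lemma convLp_ccLp (u : C_c(G, E)) (v : C_c(G, F)) :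
    B.convLp hp (ccLp 1 μ u) (ccLp p μ v) = ccLp p μ (B.ccConv u v μ) := by
  refine Lp.ext (Lp.ae_eq_of_forall_setIntegral_eq _ _ (zero_lt_one.trans_le Fact.out).ne' hp
    (fun s _ hs => integrableOn_Lp_of_measure_ne_top _ Fact.out hs.ne)
    (fun s _ hs => integrableOn_Lp_of_measure_ne_top _ Fact.out hs.ne) fun s hs hμs => ?_)
  rw [← setIntegralLp_apply s hμs.ne, convLp, ← ContinuousLinearMap.integral_comp_comm _
    (B.integrable_convIntegrand hp _ _),
    integral_congr_ae (ae_restrict_of_ae (coeFn_ccLp p (B.ccConv u v μ)))]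
  simp only [ccConv_apply]
  have hfin : IsFiniteMeasureOnCompacts (μ.restrict s) := inferInstance
  rw [← integral_integral_swap_of_hasCompactSupport
    (f := fun y x => B (y⁻¹ * x) (u y) (v (y⁻¹ * x)))]
  · refine integral_congr_ae ?_
    filter_upwards [coeFn_ccLp 1 (μ := μ) u] with y hy
    rw [setIntegralLp_apply]
    refine integral_congr_ae (ae_restrict_of_ae ?_)
    filter_upwards [B.coeFn_convIntegrand hp (ccLp 1 μ u) (ccLp p μ v) y,
      ae_mul_left (coeFn_ccLp p (μ := μ) v) y⁻¹] with x h1 h2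
    rw [h1, h2, hy]
  · exact (B.continuous_kernel u v).comp continuous_swap
  · refine HasCompactSupport.intro (K := tsupport u ×ˢ (tsupport u * tsupport v))
      (u.hasCompactSupport.prod (u.hasCompactSupport.mul v.hasCompactSupport)) fun q hq => ?_
    refine B.kernel_eq_zero fun h => hq ⟨h.1, ?_⟩
    simpa using Set.mul_mem_mul h.1 h.2

lemma ae_integral_kernel_ccLp (u : C_c(G, E)) (v : C_c(G, F)) :
    ∀ᵐ x ∂μ, Integrable (fun y => B (y⁻¹ * x) (u y) (v (y⁻¹ * x))) μ ∧
      ∫ y, B (y⁻¹ * x) (u y) (v (y⁻¹ * x)) ∂μ = B.convLp hp (ccLp 1 μ u) (ccLp p μ v) x := by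
  rw [B.convLp_ccLp hp]
  filter_upwards [coeFn_ccLp p (μ := μ) (B.ccConv u v μ)] with x hx
  exact ⟨B.integrable_kernel u v μ x, by rw [hx, ccConv_apply]⟩

/-- The pointwise formula when the second factor has compact support: the first factor is expanded
into a series, which is dominated by the convolutions of the norms. -/
lemma ae_integral_kernel_cc_right (h : Lp E 1 μ) (v : C_c(G, F)) :
    ∀ᵐ x ∂μ, Integrable (fun y => B (y⁻¹ * x) (h y) (v (y⁻¹ * x))) μ ∧
      ∫ y, B (y⁻¹ * x) (h y) (v (y⁻¹ * x)) ∂μ = B.convLp hp h (ccLp p μ v) x := by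
  obtain ⟨u, hus, huh, hu⟩ := exists_series_cc ENNReal.one_ne_top h
  refine ae_integral_eq_of_hasSum (fun n => B.ae_integral_kernel_ccLp hp (u n) v)
    (N := fun n => (realMul G).convLp hp (ccLp 1 μ (ccNorm (u n))) (ccLp p μ (ccNorm v)))
    (fun n => ?_) ?_ ?_ (B.hasSum_convLp_left hp hus huh _)
    (Eventually.of_forall fun x => hu.mono fun y hy =>
      ((B (y⁻¹ * x)).flip (v (y⁻¹ * x))).hasSum hy)
  · filter_upwards [(realMul G).ae_integral_kernel_ccLp (μ := μ) hp (ccNorm (u n)) (ccNorm v)]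
      with x hx
    rw [← hx.2]
    exact integral_mono (B.integrable_kernel (u n) v μ x).norm hx.1 fun y => B.norm_le _ _ _
  · refine Summable.of_nonneg_of_le (fun n => norm_nonneg _) (fun n => norm_convLp_le _ hp _ _)
      (Summable.mul_right _ ?_)
    simpa only [norm_ccLp_ccNorm] using hus
  · exact Summable.of_nonneg_of_le (fun n => norm_nonneg _) (fun n => norm_convLp_le _ hp _ _)
      (hus.mul_right _)

/-- The pointwise formula `(h ⋆ f)(x) = ∫ B(y⁻¹x) (h y) (f (y⁻¹x)) dy` for the convolution of
`h ∈ L¹` and `f ∈ Lp`: now the second factor is expanded into a series. -/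
theorem ae_integral_kernel (h : Lp E 1 μ) (f : Lp F p μ) :
    ∀ᵐ x ∂μ, Integrable (fun y => B (y⁻¹ * x) (h y) (f (y⁻¹ * x))) μ ∧
      ∫ y, B (y⁻¹ * x) (h y) (f (y⁻¹ * x)) ∂μ = B.convLp hp h f x := by
  obtain ⟨v, hvs, hvf, hv⟩ := exists_series_cc hp f
  have hn := (L1.integrable_coeFn h).norm
  refine ae_integral_eq_of_hasSum (fun n => B.ae_integral_kernel_cc_right hp h (v n))
    (N := fun n => (realMul G).convLp hp (hn.toL1 _) (ccLp p μ (ccNorm (v n))))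
    (fun n => ?_) ?_ ?_ (B.hasSum_convLp_right hp h hvs hvf)
    (Eventually.of_forall fun x => (ae_inv_mul hv x).mono fun y hy =>
      (B (y⁻¹ * x) (h y)).hasSum hy)
  · filter_upwards [(realMul G).ae_integral_kernel_cc_right (μ := μ) hp (hn.toL1 _) (ccNorm (v n)),
      B.ae_integral_kernel_cc_right hp h (v n)] with x hx hx2
    rw [← hx.2]
    refine integral_mono_ae hx2.1.norm hx.1 ?_
    filter_upwards [hn.coeFn_toL1] with y hy
    simp only [hy, realMul_apply, ccNorm_apply]
    exact B.norm_le _ _ _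
  · refine Summable.of_nonneg_of_le (fun n => norm_nonneg _) (fun n => norm_convLp_le _ hp _ _)
      (Summable.mul_left _ ?_)
    simpa only [norm_ccLp_ccNorm] using hvs
  · exact Summable.of_nonneg_of_le (fun n => norm_nonneg _) (fun n => norm_convLp_le _ hp _ _)
      (hvs.mul_left _)

end Pairing

section Homomorphism

/-! ### Translation on `Ruc(G)` and the two pairings -/

section RucTranslation

variable {G : Type*} [Group G] [TopologicalSpace G] [IsTopologicalGroup G]

set_option linter.unusedSectionVars false

lemma Ruc.ext_apply {m n : Ruc G} (h : ∀ z, (m : G →ᵇ ℂ) z = (n : G →ᵇ ℂ) z) : m = n :=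
  Subtype.ext (BoundedContinuousFunction.ext h)

lemma Ruc.norm_apply_le (m : Ruc G) (z : G) : ‖(m : G →ᵇ ℂ) z‖ ≤ ‖m‖ :=
  (m : G →ᵇ ℂ).norm_coe_le_norm z

lemma Ruc.norm_le_of_apply {m : Ruc G} {C : ℝ} (hC : 0 ≤ C) (h : ∀ z, ‖(m : G →ᵇ ℂ) z‖ ≤ C) :
    ‖m‖ ≤ C :=
  (BoundedContinuousFunction.norm_le hC).2 h

/-- Translation by `y` on `Ruc(G)`, as a bounded real linear map. -/
def transL (y : G) : Ruc G →L[ℝ] Ruc G :=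
  LinearMap.mkContinuous
    { toFun := trans y
      map_add' := fun _ _ => Ruc.ext_apply fun _ => rfl
      map_smul' := fun _ _ => Ruc.ext_apply fun _ => rfl } 1 fun m => by
    rw [one_mul]
    exact Ruc.norm_le_of_apply (norm_nonneg _) fun z => Ruc.norm_apply_le m _

lemma transL_apply (y : G) (m : Ruc G) : transL y m = trans y m := rfl

lemma norm_trans_le (y : G) (m : Ruc G) : ‖trans y m‖ ≤ ‖m‖ :=
  Ruc.norm_le_of_apply (norm_nonneg _) fun _ => Ruc.norm_apply_le m _

/-- Translation is jointly continuous on `G × Ruc(G)`: this is where right uniform continuity is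
used. -/
lemma continuous_trans : Continuous fun q : G × Ruc G => trans q.1 q.2 := by
  rw [continuous_iff_continuousAt]
  rintro ⟨y₀, m₀⟩
  rw [ContinuousAt, Metric.tendsto_nhds]
  intro ε hε
  have h1 : ∀ᶠ y in 𝓝 y₀, ∀ x, ‖(m₀ : G →ᵇ ℂ) ((y₀⁻¹ * y)⁻¹ * x) - (m₀ : G →ᵇ ℂ) x‖ ≤ ε / 3 := by
    have hc : Tendsto (fun y : G => y₀⁻¹ * y) (𝓝 y₀) (𝓝 1) := by
      have : Continuous fun y : G => y₀⁻¹ * y := by fun_prop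
      simpa using this.tendsto y₀
    exact hc.eventually (m₀.2 (ε / 3) (by positivity))
  filter_upwards [h1.prod_nhds (Metric.ball_mem_nhds m₀ (by positivity : 0 < ε / 3))] with q hq
  have h2 : ‖trans q.1 q.2 - trans q.1 m₀‖ ≤ ε / 3 := by
    rw [← transL_apply, ← transL_apply, ← map_sub, transL_apply]
    refine (norm_trans_le _ _).trans ?_
    rw [← dist_eq_norm]
    exact (Metric.mem_ball.1 hq.2).le
  have h3 : ‖trans q.1 m₀ - trans y₀ m₀‖ ≤ ε / 3 := by
    refine Ruc.norm_le_of_apply (by positivity) fun z => ?_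
    have := hq.1 (y₀⁻¹ * z)
    simpa [mul_assoc] using this
  rw [dist_eq_norm, ← sub_add_sub_cancel _ (trans q.1 m₀)]
  exact (norm_add_le _ _).trans_lt (by linarith)

/-- The pairing `(u, v) ↦ (T_{w⁻¹} u) v` of `Ruc(G)` with itself, which governs the twisted
convolution. -/
def twistedPairing (G : Type*) [Group G] [TopologicalSpace G] [IsTopologicalGroup G] :
    Pairing G (Ruc G) (Ruc G) (Ruc G) where
  toFun w := (ContinuousLinearMap.mul ℝ (Ruc G)).comp (transL w⁻¹)
  continuous_toFun := by
    have h : Continuous fun q : G × Ruc G × Ruc G => trans q.1⁻¹ q.2.1 * q.2.2 :=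
      (continuous_trans.comp (by fun_prop : Continuous fun q : G × Ruc G × Ruc G =>
        (q.1⁻¹, q.2.1))).mul (by fun_prop)
    exact h
  norm_le w u v := (norm_mul_le _ _).trans (by gcongr; exact norm_trans_le _ _)

lemma twistedPairing_apply (w : G) (u v : Ruc G) :
    twistedPairing G w u v = trans w⁻¹ u * v := rfl

/-- Evaluation at `w`, as a bounded real linear functional on `Ruc(G)`. -/
def evalL (w : G) : Ruc G →L[ℝ] ℂ :=
  LinearMap.mkContinuous
    { toFun := fun m => (m : G →ᵇ ℂ) w
      map_add' := fun _ _ => rfl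
      map_smul' := fun _ _ => rfl } 1 fun m => by
    rw [one_mul]
    exact Ruc.norm_apply_le m _

/-- The pairing `(u, c) ↦ u(w) c` of `Ruc(G)` with `ℂ`, which governs the operators `R(f)`. -/
def evalPairing (G : Type*) [Group G] [TopologicalSpace G] [IsTopologicalGroup G] :
    Pairing G (Ruc G) ℂ ℂ where
  toFun w := (ContinuousLinearMap.mul ℝ ℂ).comp (evalL w)
  continuous_toFun := by
    have h : Continuous fun q : G × Ruc G × ℂ => (q.2.1 : G →ᵇ ℂ) q.1 * q.2.2 := by
      have h1 : Continuous fun q : (G →ᵇ ℂ) × G => q.1 q.2 :=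
        continuous_eval
      exact (h1.comp (by fun_prop : Continuous fun q : G × Ruc G × ℂ =>
        ((q.2.1 : G →ᵇ ℂ), q.1))).mul (by fun_prop)
    exact h
  norm_le w u v := (norm_mul_le _ _).trans (by gcongr; exact Ruc.norm_apply_le u _)

lemma evalPairing_apply (w : G) (u : Ruc G) (c : ℂ) :
    evalPairing G w u c = (u : G →ᵇ ℂ) w * c := rfl

end RucTranslation

variable {G : Type*} [Group G] [TopologicalSpace G] [IsTopologicalGroup G] [LocallyCompactSpace G]
  [MeasurableSpace G] [BorelSpace G] (μ : Measure G) [μ.IsHaarMeasure]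

/-! ### Commutation relations between translations and multiplications -/

section Commutation

omit [LocallyCompactSpace G] in
lemma coeFn_lam (y : G) (f : L2 μ) : lam μ y f =ᵐ[μ] fun x => f (y⁻¹ * x) :=
  Lp.coeFn_compMeasurePreserving f (measurePreserving_mul_left μ y⁻¹)

omit [LocallyCompactSpace G] in
lemma lam_mul (y z : G) (f : L2 μ) : lam μ (y * z) f = lam μ y (lam μ z f) := by
  apply Lp.ext
  filter_upwards [coeFn_lam μ (y * z) f, coeFn_lam μ y (lam μ z f),
    ae_mul_left (coeFn_lam μ z f) y⁻¹] with x h1 h2 h3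
  rw [h1, h2, h3]
  simp [mul_assoc]

lemma mulOp_trans_lam (y : G) (m : Ruc G) (f : L2 μ) :
    mulOp μ (trans y m) (lam μ y f) = lam μ y (mulOp μ m f) := by
  apply Lp.ext
  filter_upwards [mulOp_apply μ (trans y m) (lam μ y f), coeFn_lam μ y f,
    coeFn_lam μ y (mulOp μ m f), ae_mul_left (mulOp_apply μ m f) y⁻¹] with x h1 h2 h3 h4
  rw [h1, h2, h3, h4, trans_apply]

lemma mulOp_mul (m n : Ruc G) (f : L2 μ) : mulOp μ (m * n) f = mulOp μ m (mulOp μ n f) := by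
  apply Lp.ext
  filter_upwards [mulOp_apply μ (m * n) f, mulOp_apply μ m (mulOp μ n f), mulOp_apply μ n f]
    with x h1 h2 h3
  rw [h1, h2, h3, ← mul_assoc]
  rfl

lemma lam_mulOp_trans_inv (y : G) (m : Ruc G) (f : L2 μ) :
    lam μ y (mulOp μ (trans y⁻¹ m) f) = mulOp μ m (lam μ y f) := by
  rw [← mulOp_trans_lam]
  congr 2
  exact Ruc.ext_apply fun z => by simp

omit [LocallyCompactSpace G] in
lemma inner_lam_left (y : G) (f g : L2 μ) :
    ⟪lam μ y f, g⟫_ℂ = ⟪f, lam μ y⁻¹ g⟫_ℂ := by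
  rw [← (lam μ y).inner_map_map f, ← lam_mul, mul_inv_cancel]
  congr 1
  apply Lp.ext
  filter_upwards [coeFn_lam μ 1 g] with x hx
  rw [hx]
  simp

lemma inner_mulOp_star_left (m : Ruc G) (f g : L2 μ) :
    ⟪mulOp μ (star m) f, g⟫_ℂ = ⟪f, mulOp μ m g⟫_ℂ := by
  rw [L2.inner_def, L2.inner_def]
  refine integral_congr_ae ?_
  filter_upwards [mulOp_apply μ (star m) f, mulOp_apply μ m g] with x h1 h2
  rw [h1, h2]
  simp only [RCLike.inner_apply]
  have : ((star m : Ruc G) : G →ᵇ ℂ) x = star ((m : G →ᵇ ℂ) x) := rfl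
  rw [this, map_mul]
  simp
  ring

end Commutation

variable [μ.Regular] [T2Space G]

/-! ### The map `R` on elementary tensors -/

lemma R_tensor (a : Lp ℂ 1 μ) (m : Ruc G) : R μ (tensor μ a m) = lamInt μ a ∘L mulOp μ m := by
  ext1 h
  rw [R_apply, ContinuousLinearMap.comp_apply, lamInt_apply]
  refine integral_congr_ae ?_
  filter_upwards [(ContinuousLinearMap.toSpanSingleton ℂ m).coeFn_compLp a] with y hy
  rw [tensor, hy]
  simp

/-- Elementary tensors span a dense subspace, so `R` is determined by its values on them. -/
lemma eq_R_of_tensor (S : TwistedL1 μ →L[ℂ] L2 μ →L[ℂ] L2 μ)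
    (hS : ∀ (a : Lp ℂ 1 μ) (m : Ruc G), S (tensor μ a m) = lamInt μ a ∘L mulOp μ m) :
    S = R μ := by
  ext1 f
  refine Lp.induction ENNReal.one_ne_top (motive := fun f => S f = R μ f) ?_ ?_ ?_ f
  · intro c s hs hμs
    have e : (Lp.simpleFunc.indicatorConst 1 hs hμs.ne c : TwistedL1 μ)
        = tensor μ (indicatorConstLp 1 hs hμs.ne (1 : ℂ)) c := by
      rw [Lp.simpleFunc.coe_indicatorConst]
      apply Lp.ext
      filter_upwards [(ContinuousLinearMap.toSpanSingleton ℂ c).coeFn_compLp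
        (indicatorConstLp 1 hs hμs.ne (1 : ℂ)), indicatorConstLp_coeFn (p := 1) (hs := hs)
        (hμs := hμs.ne) (c := (1 : ℂ)), indicatorConstLp_coeFn (p := 1) (hs := hs)
        (hμs := hμs.ne) (c := c)] with x h1 h2 h3
      rw [tensor, h1, h2, h3]
      by_cases hx : x ∈ s <;> simp [hx]
    rw [e, hS, R_tensor]
  · intro f g hf hg _ h1 h2
    rw [map_add, map_add, h1, h2]
  · exact isClosed_eq S.continuous (R μ).continuous

/-! ### Multiplicativity -/

/-- `R` intertwines left translation on `L¹(G, Ruc(G))` with `λ(y)`. -/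
lemma R_transLp (y : G) (g : TwistedL1 μ) (k : L2 μ) :
    R μ (transLp μ y g) k = lam μ y (R μ g k) := by
  have h1 : R μ (transLp μ y g) k = ∫ z, lam μ z (mulOp μ (g (y⁻¹ * z)) k) ∂μ := by
    rw [R_apply]
    refine integral_congr_ae ?_
    filter_upwards [coeFn_transLp y g] with z hz
    rw [hz]
  rw [h1, ← integral_mul_left_eq_self _ y, R_apply]
  simp only [inv_mul_cancel_left, lam_mul]
  exact (lam μ y).toContinuousLinearMap.integral_comp_comm (integrable_lam μ (mulOp μ) g k)

/-- `R` intertwines `g ↦ (w ↦ T_{w⁻¹}(u) g(w))` with `D^u`. -/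
lemma R_mulLp_twistedPairing (u : Ruc G) (g : TwistedL1 μ) (k : L2 μ) :
    R μ ((twistedPairing G).mulLp ENNReal.one_ne_top u g) k = mulOp μ u (R μ g k) := by
  have h1 : ∫ w, mulOp μ u (lam μ w (mulOp μ (g w) k)) ∂μ = mulOp μ u (R μ g k) :=
    (mulOp μ u).integral_comp_comm (integrable_lam μ (mulOp μ) g k)
  rw [← h1, R_apply]
  refine integral_congr_ae ?_
  filter_upwards [(twistedPairing G).coeFn_mulLp ENNReal.one_ne_top u g] with w hw
  rw [hw, twistedPairing_apply, mulOp_mul, lam_mulOp_trans_inv]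

/-- `R` is applied under the Bochner integral that defines the twisted convolution. -/
lemma R_convLp_twistedPairing (h f : TwistedL1 μ) :
    R μ ((twistedPairing G).convLp ENNReal.one_ne_top h f) = R μ h ∘L R μ f := by
  ext1 k
  have h1 := ((R μ).flip k).integral_comp_comm
    ((twistedPairing G).integrable_convIntegrand ENNReal.one_ne_top h f)
  rw [ContinuousLinearMap.flip_apply] at h1
  rw [Pairing.convLp, ← h1, ContinuousLinearMap.comp_apply, R_apply μ h]
  refine integral_congr_ae (Eventually.of_forall fun y => ?_)
  simp only [ContinuousLinearMap.flip_apply, Pairing.convIntegrand]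
  rw [R_transLp, R_mulLp_twistedPairing]

/-- The substitution `y ↦ xy` turns the kernel of the pairing into the twisted integrand. -/
lemma ae_integrable_twistedIntegrand (h f : TwistedL1 μ) :
    ∀ᵐ x ∂μ, Integrable (twistedIntegrand h f x) μ ∧
      twistedConv μ h f x = (twistedPairing G).convLp ENNReal.one_ne_top h f x := by
  filter_upwards [(twistedPairing G).ae_integral_kernel ENNReal.one_ne_top h f] with x hx
  have e : twistedIntegrand h f x = fun y => (fun y => twistedPairing G (y⁻¹ * x) (h y)
      (f (y⁻¹ * x))) (x * y) := by
    ext1 y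
    simp [twistedIntegrand, twistedPairing_apply]
  refine ⟨?_, ?_⟩
  · rw [e]
    exact hx.1.comp_mul_left x
  · rw [twistedConv, e, integral_mul_left_eq_self, hx.2]

lemma integrable_twistedConv (h f : TwistedL1 μ) : Integrable (twistedConv μ h f) μ :=
  (L1.integrable_coeFn _).congr
    ((ae_integrable_twistedIntegrand μ h f).mono fun _ hx => hx.2.symm)

lemma R_twistedConv (h f : TwistedL1 μ) :
    R μ ((integrable_twistedConv μ h f).toL1 (twistedConv μ h f)) = R μ h ∘L R μ f := by
  rw [← R_convLp_twistedPairing]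
  congr 1
  apply Lp.ext
  filter_upwards [(integrable_twistedConv μ h f).coeFn_toL1,
    ae_integrable_twistedIntegrand μ h f] with x h1 h2
  rw [h1, h2.2]

/-! ### Involution -/

lemma integrable_twistedStar (h : TwistedL1 μ) : Integrable (twistedStar h) μ := by
  have h1 : Integrable (fun x => star (trans x (h x))) μ := by
    obtain ⟨u, -, -, hu⟩ := exists_series_cc ENNReal.one_ne_top h
    refine (L1.integrable_coeFn h).norm.mono' (aestronglyMeasurable_of_hasSum
      (F := fun n x => star (trans x (u n x))) (fun n => ?_)
      (hu.mono fun x hx => ((transL x).hasSum hx).star))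
      (Eventually.of_forall fun x => (norm_star _).trans_le (norm_trans_le _ _))
    have hc : Continuous fun x => star (trans x (u n x)) :=
      (continuous_trans.comp (continuous_id.prodMk (map_continuous (u n)))).star
    refine (hc.stronglyMeasurable_of_hasCompactSupport ?_).aestronglyMeasurable
    refine HasCompactSupport.intro (u n).hasCompactSupport fun x hx => ?_
    rw [image_eq_zero_of_notMem_tsupport hx, ← transL_apply, map_zero, star_zero]
  refine (integrable_integral_Δ_inv_smul h1).1.congr (Eventually.of_forall fun x => ?_)
  rfl

lemma inner_R_right (f : TwistedL1 μ) (k l : L2 μ) :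
    ⟪k, R μ f l⟫_ℂ = ∫ x, ⟪k, lam μ x (mulOp μ (f x) l)⟫_ℂ ∂μ :=
  (integral_inner (integrable_lam μ (mulOp μ) f l) k).symm

lemma inner_R_left (f : TwistedL1 μ) (k l : L2 μ) :
    ⟪R μ f k, l⟫_ℂ = ∫ x, ⟪lam μ x (mulOp μ (f x) k), l⟫_ℂ ∂μ := by
  rw [← inner_conj_symm, inner_R_right, ← integral_conj]
  simp only [inner_conj_symm]

lemma R_twistedStar (h : TwistedL1 μ) :
    R μ ((integrable_twistedStar μ h).toL1 (twistedStar h)) =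
      ContinuousLinearMap.adjoint (R μ h) := by
  rw [ContinuousLinearMap.eq_adjoint_iff]
  intro k l
  have h1 := (integrable_lam μ (mulOp μ) h l).const_inner (𝕜 := ℂ) k
  rw [inner_R_left, inner_R_right, ← (integrable_integral_Δ_inv_smul h1).2]
  refine integral_congr_ae ?_
  filter_upwards [(integrable_twistedStar μ h).coeFn_toL1] with x hx
  rw [hx, inner_lam_left, twistedStar, map_smul, smul_apply, inner_smul_left,
    inner_mulOp_star_left, mulOp_trans_lam]
  simp

end Homomorphism

/-! ### The upper bound for the norm of a convolution dominated operator -/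

section UpperBound

variable {G : Type*} [Group G] [TopologicalSpace G] [IsTopologicalGroup G] [LocallyCompactSpace G]
  [MeasurableSpace G] [BorelSpace G] (μ : Measure G) [μ.IsHaarMeasure] [μ.Regular] [T2Space G]

lemma R_eq_convLp (f : TwistedL1 μ) (k : L2 μ) :
    R μ f k = (evalPairing G).convLp ENNReal.ofNat_ne_top f k := by
  rw [R_apply]
  refine integral_congr_ae (Eventually.of_forall fun y => ?_)
  have e : mulOp μ (f y) k = (evalPairing G).mulLp ENNReal.ofNat_ne_top (f y) k := by
    apply Lp.ext
    filter_upwards [mulOp_apply μ (f y) k,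
      (evalPairing G).coeFn_mulLp (μ := μ) ENNReal.ofNat_ne_top (f y) k] with x h1 h2
    rw [h1, h2, evalPairing_apply]
  simp only [e]
  rfl

/-- The operator `R(f)` as a twisted convolution of functions. -/
lemma ae_R_apply (f : TwistedL1 μ) (k : L2 μ) :
    ∀ᵐ x ∂μ, Integrable (fun y => (f y : G →ᵇ ℂ) (y⁻¹ * x) * k (y⁻¹ * x)) μ ∧
      ∫ y, (f y : G →ᵇ ℂ) (y⁻¹ * x) * k (y⁻¹ * x) ∂μ = R μ f k x := by
  rw [R_eq_convLp]
  exact (evalPairing G).ae_integral_kernel ENNReal.ofNat_ne_top f k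

lemma ae_integrable_conv (a : Lp ℝ 1 μ) (k : L2 μ) :
    ∀ᵐ x ∂μ, Integrable (fun y => a y * ‖k (y⁻¹ * x)‖) μ := by
  have hk := (Lp.memLp k).norm
  filter_upwards [(Pairing.realMul G).ae_integral_kernel (μ := μ) ENNReal.ofNat_ne_top a
    (hk.toLp _)] with x hx
  refine hx.1.congr ?_
  filter_upwards [ae_inv_mul hk.coeFn_toLp x] with y hy
  rw [hy, Pairing.realMul_apply]

variable {μ}

/-- The class of `x ↦ ‖f x‖` in `L¹(G)`. -/
def normL1 (f : TwistedL1 μ) : Lp ℝ 1 μ := (L1.integrable_coeFn f).norm.toL1 _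

omit [LocallyCompactSpace G] [μ.IsHaarMeasure] [μ.Regular] [T2Space G] [BorelSpace G]
  [IsTopologicalGroup G] in
lemma coeFn_normL1 (f : TwistedL1 μ) : normL1 f =ᵐ[μ] fun x => ‖f x‖ :=
  (L1.integrable_coeFn f).norm.coeFn_toL1

omit [LocallyCompactSpace G] [μ.IsHaarMeasure] [μ.Regular] [T2Space G] [BorelSpace G]
  [IsTopologicalGroup G] in
lemma norm_normL1 (f : TwistedL1 μ) : ‖normL1 f‖ = ‖f‖ := by
  rw [L1.norm_eq_integral_norm, L1.norm_eq_integral_norm]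
  refine integral_congr_ae ?_
  filter_upwards [coeFn_normL1 f] with x hx
  rw [hx, norm_norm]

lemma isDominatedBy_R (f : TwistedL1 μ) : IsDominatedBy μ (R μ f) (normL1 f) := by
  intro k
  filter_upwards [ae_R_apply μ f k, ae_integrable_conv μ (normL1 f) k] with x h1 h2
  rw [← h1.2, conv]
  refine norm_integral_le_of_norm_le h2 ?_
  filter_upwards [coeFn_normL1 f] with y hy
  rw [hy, norm_mul]
  gcongr
  exact Ruc.norm_apply_le _ _

/-- Domination is stable under perturbation of `f` in `L¹(G, Ruc(G))`. -/
lemma IsDominatedBy.of_sub {f g : TwistedL1 μ} {a : Lp ℝ 1 μ} (h : IsDominatedBy μ (R μ f) a) :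
    IsDominatedBy μ (R μ g) (a + normL1 (g - f)) := by
  intro k
  have e : R μ g k = R μ f k + R μ (g - f) k := by
    rw [← add_apply, ← map_add, add_sub_cancel]
  rw [e]
  filter_upwards [h k, isDominatedBy_R (g - f) k, ae_integrable_conv μ a k,
    ae_integrable_conv μ (normL1 (g - f)) k, Lp.coeFn_add (R μ f k) (R μ (g - f) k)]
    with x h1 h2 h3 h4 h5
  rw [h5, Pi.add_apply]
  refine (norm_add_le _ _).trans ((add_le_add h1 h2).trans_eq ?_)
  rw [conv, conv, conv, ← integral_add h3 h4]
  refine integral_congr_ae ?_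
  filter_upwards [Lp.coeFn_add a (normL1 (g - f))] with y hy
  rw [hy, Pi.add_apply, add_mul]

end UpperBound

/-! ### Nonnegativity tested on compactly supported functions -/

section Testing

/-- An integrable function with nonnegative integral against every nonnegative compactly supported
continuous function is nonnegative almost everywhere. -/
lemma ae_nonneg_of_integral_mul_nonneg {X : Type*} [TopologicalSpace X] [MeasurableSpace X]
    [BorelSpace X] [T2Space X] [LocallyCompactSpace X] {μ : Measure X} [μ.Regular] {g : X → ℝ}
    (hg : Integrable g μ)
    (h : ∀ ψ : C_c(X, ℝ), (∀ x, 0 ≤ ψ x) → 0 ≤ ∫ x, ψ x * g x ∂μ) : 0 ≤ᵐ[μ] g := by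
  have key : ∀ ε : ℝ, 0 < ε → ∫ x, max (-g x) 0 ∂μ ≤ 2 * ε := by
    intro ε hε
    obtain ⟨v, hv⟩ := exists_cc_eLpNorm_sub_le ENNReal.one_ne_top (memLp_one_iff_integrable.2 hg)
      (ε := ENNReal.ofReal ε) (by simpa using hε)
    have hvi : Integrable v μ := v.continuous.integrable_of_hasCompactSupport v.hasCompactSupport
    have hd : ∫ x, |g x - v x| ∂μ ≤ ε := by
      have h1 := integral_norm_eq_lintegral_enorm (hg.sub hvi).1
      rw [← eLpNorm_one_eq_lintegral_enorm] at h1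
      calc _ = (eLpNorm (g - ⇑v) 1 μ).toReal := h1
        _ ≤ ε := ENNReal.toReal_le_of_le_ofReal hε.le hv
    have hdi : Integrable (fun x => |g x - v x|) μ := (hg.sub hvi).norm
    set m : X → ℝ := fun x => max (-v x) 0 with hm
    have hm0 : ∀ x, 0 ≤ m x := fun x => le_max_right _ _
    have hmc : Continuous m := by
      have := map_continuous v
      fun_prop
    have hmz : ∀ x, x ∉ tsupport v → m x = 0 := fun x hx => by
      simp [hm, image_eq_zero_of_notMem_tsupport hx]
    have hmi : Integrable m μ := hmc.integrable_of_hasCompactSupport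
      (HasCompactSupport.intro v.hasCompactSupport hmz)
    have hμK : μ (tsupport v) < ∞ := v.hasCompactSupport.measure_lt_top
    -- Test against `m / (m + δ)`, an approximation of the indicator of `{v < 0}`.
    have hδ : ∀ δ : ℝ, 0 < δ → ∫ x, m x ∂μ ≤ ε + δ * μ.real (tsupport v) := by
      intro δ hδ
      have hpos : ∀ x, 0 < m x + δ := fun x => by linarith [hm0 x]
      let ψ : C_c(X, ℝ) := ⟨⟨fun x => m x / (m x + δ), hmc.div (by fun_prop) fun x => (hpos x).ne'⟩,
        HasCompactSupport.intro v.hasCompactSupport fun x hx => by simp [hmz x hx]⟩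
      have hψ : ∀ x, ψ x = m x / (m x + δ) := fun _ => rfl
      have hψ0 : ∀ x, 0 ≤ ψ x := fun x => div_nonneg (hm0 x) (hpos x).le
      have hψ1 : ∀ x, ψ x ≤ 1 := fun x => by
        rw [hψ, div_le_one (hpos x)]; linarith
      have hle : ∀ x, ψ x * g x + m x ≤ |g x - v x| + (tsupport v).indicator (fun _ => δ) x := by
        intro x
        have h1 : ψ x * (g x - v x) ≤ |g x - v x| :=
          (mul_le_mul_of_nonneg_left (le_abs_self _) (hψ0 x)).trans
            (mul_le_of_le_one_left (abs_nonneg _) (hψ1 x))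
        have h2 : ψ x * v x + m x ≤ (tsupport v).indicator (fun _ => δ) x := by
          by_cases hx : x ∈ tsupport v
          · rw [Set.indicator_of_mem hx]
            have h4 : ψ x * v x = -(ψ x * m x) := by
              rcases le_total (v x) 0 with h3 | h3
              · have : m x = -v x := max_eq_left (by linarith)
                rw [this]; ring
              · have : m x = 0 := max_eq_right (by linarith)
                rw [hψ, this]; simp
            have h5 : m x * (1 - ψ x) ≤ δ := by
              have : m x * (1 - ψ x) = ψ x * δ := by
                rw [hψ]; field_simp [(hpos x).ne']; ring
              rw [this]
              exact mul_le_of_le_one_left hδ.le (hψ1 x)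
            linarith
          · simp [hx, hmz x hx, image_eq_zero_of_notMem_tsupport hx]
        linarith
      have hψg : Integrable (fun x => ψ x * g x) μ :=
        hg.bdd_mul (c := 1) (ψ.continuous.stronglyMeasurable_of_hasCompactSupport
          ψ.hasCompactSupport).aestronglyMeasurable (Eventually.of_forall fun x => by
            rw [Real.norm_eq_abs]; exact (abs_of_nonneg (hψ0 x)).trans_le (hψ1 x))
      have hK : Integrable ((tsupport v).indicator fun _ => δ) μ :=
        (integrable_indicator_iff v.hasCompactSupport.measurableSet).2 (integrableOn_const hμK.ne)
      have h6 := integral_mono (hψg.add hmi) (hdi.add hK) hle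
      rw [integral_add' hψg hmi, integral_add' hdi hK,
        integral_indicator_const _ v.hasCompactSupport.measurableSet, smul_eq_mul] at h6
      linarith [h ψ hψ0, mul_comm (μ.real (tsupport v)) δ]
    have hmε : ∫ x, m x ∂μ ≤ ε := by
      refine le_of_forall_pos_le_add fun η hη => ?_
      refine (hδ (η / (μ.real (tsupport v) + 1)) (by positivity)).trans ?_
      gcongr
      rw [div_mul_eq_mul_div, div_le_iff₀ (by positivity)]
      nlinarith
    have h7 : ∀ x, max (-g x) 0 ≤ m x + |g x - v x| := fun x =>
      max_le (by linarith [le_max_left (-v x) 0, neg_abs_le (g x - v x)])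
        (add_nonneg (hm0 x) (abs_nonneg _))
    have h8 := integral_mono hg.neg.pos_part (hmi.add hdi) h7
    rw [integral_add' hmi hdi] at h8
    have h9 : ∫ x, max (-g x) 0 ∂μ = ∫ x, max ((-g) x) 0 ∂μ := rfl
    rw [h9]
    linarith
  have h0 : ∫ x, max (-g x) 0 ∂μ ≤ 0 := by
    refine le_of_forall_pos_le_add fun ε hε => ?_
    linarith [key (ε / 2) (by positivity)]
  have h1 := (integral_eq_zero_iff_of_nonneg (fun x => le_max_right _ _)
    hg.neg.pos_part).1 (le_antisymm h0 (integral_nonneg fun x => le_max_right _ _))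
  filter_upwards [h1] with x hx
  have : max (-g x) 0 = 0 := hx
  have := max_eq_right_iff.1 this
  simpa using this

end Testing

/-! ### The lower bound for the norm of a convolution dominated operator -/

section LowerBound

variable {G : Type*} [Group G] [TopologicalSpace G] [IsTopologicalGroup G]

/-- The pairing `(u, c) ↦ Re (θ u(w)) c`, for `|θ| ≤ 1`. -/
def rePairing (G : Type*) [Group G] [TopologicalSpace G] [IsTopologicalGroup G] (θ : ℂ)
    (hθ : ‖θ‖ ≤ 1) : Pairing G (Ruc G) ℝ ℝ where
  toFun w := (ContinuousLinearMap.mul ℝ ℝ).comp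
    ((Complex.reCLM.comp (ContinuousLinearMap.mul ℝ ℂ θ)).comp (evalL w))
  continuous_toFun := by
    have h : Continuous fun q : G × Ruc G × ℝ => (θ * (q.2.1 : G →ᵇ ℂ) q.1).re * q.2.2 := by
      have h1 : Continuous fun q : (G →ᵇ ℂ) × G => q.1 q.2 := continuous_eval
      exact (Complex.continuous_re.comp (continuous_const.mul
        (h1.comp (by fun_prop : Continuous fun q : G × Ruc G × ℝ =>
          ((q.2.1 : G →ᵇ ℂ), q.1))))).mul (by fun_prop)
    exact h
  norm_le w u v := by
    refine (norm_mul_le _ _).trans ?_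
    gcongr
    refine (Complex.abs_re_le_norm _).trans ((norm_mul_le _ _).trans ?_)
    exact (mul_le_of_le_one_left (norm_nonneg _) hθ).trans (Ruc.norm_apply_le u w)

lemma rePairing_apply (θ : ℂ) (hθ : ‖θ‖ ≤ 1) (w : G) (u : Ruc G) (c : ℝ) :
    rePairing G θ hθ w u c = (θ * (u : G →ᵇ ℂ) w).re * c := rfl

omit [Group G] [IsTopologicalGroup G] in
/-- If `q(·, w)` is supported in a fixed compact set `K` for `w` near `z`, then `q(·, w) → q(·, z)`
uniformly as `w → z`.  No countability of the neighbourhoods of `z` is needed, so this replaces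
dominated convergence. -/
lemma eventually_forall_abs_sub_le {X : Type*} [TopologicalSpace X] {q : X → G → ℝ}
    (hq : Continuous (Function.uncurry q)) {K : Set X} (hK : IsCompact K) {z : G}
    (h0 : ∀ᶠ w in 𝓝 z, ∀ y ∉ K, q y w = 0) {ε : ℝ} (hε : 0 < ε) :
    ∀ᶠ w in 𝓝 z, ∀ y, |q y w - q y z| ≤ K.indicator (fun _ => ε) y := by
  have h1 : ∀ᶠ w in 𝓝 z, ∀ y ∈ K, |q y w - q y z| < ε := by
    refine hK.eventually_forall_of_forall_eventually fun y _ => ?_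
    have hc : Continuous fun r : G × X => |q r.2 r.1 - q r.2 z| :=
      ((hq.comp (by fun_prop : Continuous fun r : G × X => (r.2, r.1))).sub
        (hq.comp (by fun_prop : Continuous fun r : G × X => (r.2, z)))).abs
    exact hc.continuousAt.eventually_lt continuousAt_const (by simpa using hε)
  filter_upwards [h1, h0] with w h2 h3 y
  by_cases hy : y ∈ K
  · rw [Set.indicator_of_mem hy]
    exact (h2 y hy).le
  · rw [Set.indicator_of_notMem hy, h3 y hy, h0.self_of_nhds y hy, sub_zero, abs_zero]

variable [LocallyCompactSpace G] [MeasurableSpace G] [BorelSpace G] (μ : Measure G)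
  [μ.IsHaarMeasure]

/-- Approximate delta functions. -/
lemma exists_cc_integral_eq_one [T2Space G] {z : G} {V : Set G}
    (hV : V ∈ 𝓝 z) :
    ∃ k : C_c(G, ℝ), (∀ w, 0 ≤ k w) ∧ (∀ w ∉ V, k w = 0) ∧ ∫ w, k w ∂μ = 1 := by
  obtain ⟨φ, hφ1, hφ0, hφc, hφ⟩ := exists_continuous_one_zero_of_isCompact
    (isCompact_singleton (x := z)) isOpen_interior.isClosed_compl (t := (interior V)ᶜ)
    (by simpa [mem_interior_iff_mem_nhds] using hV)
  have hI : 0 < ∫ w, φ w ∂μ := φ.continuous.integral_pos_of_hasCompactSupport_nonneg_nonzero hφc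
    (fun w => (hφ w).1) (x := z) (by simp [hφ1 (Set.mem_singleton z)])
  refine ⟨⟨⟨fun w => (∫ w, φ w ∂μ)⁻¹ * φ w, by fun_prop⟩, hφc.mul_left⟩, fun w => ?_,
    fun w hw => ?_, ?_⟩
  · exact mul_nonneg (inv_nonneg.2 hI.le) (hφ w).1
  · have : φ w = 0 := hφ0 fun h => hw (interior_subset h)
    change _ * φ w = 0
    rw [this, mul_zero]
  · change ∫ w, (∫ w, φ w ∂μ)⁻¹ * φ w ∂μ = 1
    rw [integral_const_mul, inv_mul_cancel₀ hI.ne']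

omit [Group G] [IsTopologicalGroup G] [LocallyCompactSpace G] [μ.IsHaarMeasure] in
lemma abs_integral_mul_sub_le [IsFiniteMeasureOnCompacts μ] {k : C_c(G, ℝ)} (hk : ∀ w, 0 ≤ k w)
    (hk1 : ∫ w, k w ∂μ = 1) {q : G → ℝ} (hq : Continuous q) {c η : ℝ}
    (h : ∀ w, k w ≠ 0 → |q w - c| ≤ η) : |∫ w, q w * k w ∂μ - c| ≤ η := by
  have hki : Integrable k μ := k.continuous.integrable_of_hasCompactSupport k.hasCompactSupport
  have hqk : Integrable (fun w => q w * k w) μ :=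
    (hq.mul (map_continuous k)).integrable_of_hasCompactSupport k.hasCompactSupport.mul_left
  have e : ∫ w, q w * k w ∂μ - c = ∫ w, (q w - c) * k w ∂μ := by
    simp only [sub_mul]
    rw [integral_sub hqk (hki.const_mul c), integral_const_mul, hk1, mul_one]
  rw [e, ← Real.norm_eq_abs]
  refine (norm_integral_le_of_norm_le (hki.const_mul η) (Eventually.of_forall fun w => ?_)).trans_eq
    (by rw [integral_const_mul, hk1, mul_one])
  rw [norm_mul, Real.norm_eq_abs, Real.norm_eq_abs, abs_of_nonneg (hk w)]
  by_cases hw : k w = 0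
  · simp [hw]
  · exact mul_le_mul_of_nonneg_right (h w hw) (hk w)

variable [μ.Regular] [T2Space G]

/-- Testing a convolution in `L¹(G)` against a compactly supported continuous function. -/
lemma integral_mul_convLp {E : Type*} [NormedAddCommGroup E] [NormedSpace ℝ E] [CompleteSpace E]
    (B : Pairing G E ℝ ℝ) (φ k : C_c(G, ℝ)) (h : Lp E 1 μ) :
    Integrable (fun y => ∫ w, φ (y * w) * B w (h y) (k w) ∂μ) μ ∧
      ∫ x, φ x * B.convLp ENNReal.one_ne_top h (ccLp 1 μ k) x ∂μ =
        ∫ y, ∫ w, φ (y * w) * B w (h y) (k w) ∂μ ∂μ := by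
  obtain ⟨C, hC⟩ := φ.hasCompactSupport.exists_bound_of_continuous φ.continuous
  have hφi : ∀ g : Lp ℝ 1 μ, Integrable (fun x => φ x * g x) μ := fun g =>
    (L1.integrable_coeFn g).bdd_mul (c := C) (φ.continuous.stronglyMeasurable_of_hasCompactSupport
      φ.hasCompactSupport).aestronglyMeasurable (Eventually.of_forall hC)
  let Φ : Lp ℝ 1 μ →L[ℝ] ℝ := LinearMap.mkContinuous
    { toFun := fun g => ∫ x, φ x * g x ∂μ
      map_add' := fun f g => by
        rw [← integral_add (hφi f) (hφi g)]
        refine integral_congr_ae ?_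
        filter_upwards [Lp.coeFn_add f g] with x hx
        rw [hx, Pi.add_apply, mul_add]
      map_smul' := fun c f => by
        rw [RingHom.id_apply, ← integral_smul]
        refine integral_congr_ae ?_
        filter_upwards [Lp.coeFn_smul c f] with x hx
        rw [hx, Pi.smul_apply, smul_eq_mul, smul_eq_mul, mul_left_comm] } C fun g => by
    rw [L1.norm_eq_integral_norm, ← integral_const_mul]
    refine norm_integral_le_of_norm_le ((L1.integrable_coeFn g).norm.const_mul C)
      (Eventually.of_forall fun x => ?_)
    rw [norm_mul]
    exact mul_le_mul_of_nonneg_right (hC x) (norm_nonneg _)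
  have hΦ : ∀ y, Φ (B.convIntegrand ENNReal.one_ne_top h (ccLp 1 μ k) y)
      = ∫ w, φ (y * w) * B w (h y) (k w) ∂μ := by
    intro y
    have h1 : Φ (B.convIntegrand ENNReal.one_ne_top h (ccLp 1 μ k) y)
        = ∫ x, φ x * B (y⁻¹ * x) (h y) (k (y⁻¹ * x)) ∂μ := by
      refine integral_congr_ae ?_
      filter_upwards [B.coeFn_convIntegrand ENNReal.one_ne_top h (ccLp 1 μ k) y,
        ae_mul_left (coeFn_ccLp 1 (μ := μ) k) y⁻¹] with x h1 h2
      rw [h1, h2]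
    rw [h1, ← integral_mul_left_eq_self _ y]
    simp
  have hi := B.integrable_convIntegrand ENNReal.one_ne_top h (ccLp 1 μ k)
  refine ⟨(Φ.integrable_comp hi).congr (Eventually.of_forall hΦ), ?_⟩
  have h2 := Φ.integral_comp_comm hi
  simp only [hΦ] at h2
  rw [h2]
  rfl

variable {μ}

/-- The domination inequality for real nonnegative test functions, as an inequality in `L¹(G)`. -/
lemma ae_rePairing_convLp_le {f : TwistedL1 μ} {a : Lp ℝ 1 μ} (hd : IsDominatedBy μ (R μ f) a)
    {θ : ℂ} (hθ : ‖θ‖ ≤ 1) {k : C_c(G, ℝ)} (hk : ∀ w, 0 ≤ k w) :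
    ∀ᵐ x ∂μ, (rePairing G θ hθ).convLp ENNReal.one_ne_top f (ccLp 1 μ k) x ≤
      (Pairing.realMul G).convLp ENNReal.one_ne_top a (ccLp 1 μ k) x := by
  let kc : C_c(G, ℂ) := ⟨⟨fun w => (k w : ℂ), by have := map_continuous k; fun_prop⟩,
    k.hasCompactSupport.comp_left (g := fun t : ℝ => (t : ℂ)) Complex.ofReal_zero⟩
  have hkc : ∀ w, kc w = (k w : ℂ) := fun _ => rfl
  filter_upwards [hd (ccLp 2 μ kc), ae_R_apply μ f (ccLp 2 μ kc),
    (rePairing G θ hθ).ae_integral_kernel ENNReal.one_ne_top f (ccLp 1 μ k),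
    (Pairing.realMul G).ae_integral_kernel ENNReal.one_ne_top a (ccLp 1 μ k)] with x h1 h2 h3 h4
  rw [← h3.2, ← h4.2]
  have e1 : ∫ y, rePairing G θ hθ (y⁻¹ * x) (f y) (ccLp 1 μ k (y⁻¹ * x)) ∂μ
      = (θ * R μ f (ccLp 2 μ kc) x).re := by
    rw [← h2.2]
    refine Eq.trans (integral_congr_ae ?_)
      ((Complex.reCLM.comp (ContinuousLinearMap.mul ℝ ℂ θ)).integral_comp_comm h2.1)
    filter_upwards [ae_inv_mul (coeFn_ccLp 1 (μ := μ) k) x, ae_inv_mul (coeFn_ccLp 2 (μ := μ) kc) x]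
      with y h5 h6
    rw [h5, h6, hkc, rePairing_apply]
    simp [← mul_assoc]
  have e2 : ∫ y, Pairing.realMul G (y⁻¹ * x) (a y) (ccLp 1 μ k (y⁻¹ * x)) ∂μ
      = conv μ a (fun z => ‖ccLp 2 μ kc z‖) x := by
    refine integral_congr_ae ?_
    filter_upwards [ae_inv_mul (coeFn_ccLp 1 (μ := μ) k) x, ae_inv_mul (coeFn_ccLp 2 (μ := μ) kc) x]
      with y h5 h6
    rw [h5, h6, hkc, Pairing.realMul_apply, Complex.norm_real, Real.norm_eq_abs,
      abs_of_nonneg (hk _)]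
  rw [e1, e2]
  refine (Complex.re_le_norm _).trans (le_trans ?_ h1)
  rw [norm_mul]
  exact mul_le_of_le_one_left (norm_nonneg _) hθ

open scoped Pointwise in
/-- For `u` of compact support, a dominating function `a` of `R(u)` satisfies
`Re (θ u(y)(z)) ≤ a(y)` in the weak sense: the domination inequality is tested against an
approximate delta function at `z`. -/
lemma integral_mul_re_le {u : C_c(G, Ruc G)} {a : Lp ℝ 1 μ}
    (hd : IsDominatedBy μ (R μ (ccLp 1 μ u)) a) {θ : ℂ} (hθ : ‖θ‖ ≤ 1) (z : G) {φ : C_c(G, ℝ)}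
    (hφ : ∀ x, 0 ≤ φ x) :
    ∫ y, φ (y * z) * (θ * (u y : G →ᵇ ℂ) z).re ∂μ ≤ ∫ y, a y * φ (y * z) ∂μ := by
  obtain ⟨C, hC⟩ := φ.hasCompactSupport.exists_bound_of_continuous φ.continuous
  have hφc : Continuous fun r : G × G => φ (r.1 * r.2) := (map_continuous φ).comp continuous_mul
  set g : G → G → ℝ := fun y w => φ (y * w) * (θ * (u y : G →ᵇ ℂ) w).re with hg
  have hgc : Continuous (Function.uncurry g) := by
    have h1 : Continuous fun q : (G →ᵇ ℂ) × G => q.1 q.2 := continuous_eval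
    have hu := map_continuous u
    have h2 : Continuous fun r : G × G => (u r.1 : G →ᵇ ℂ) r.2 :=
      h1.comp (by fun_prop : Continuous fun r : G × G => ((u r.1 : G →ᵇ ℂ), r.2))
    exact hφc.mul (Complex.continuous_re.comp (continuous_const.mul h2))
  have hg0 : ∀ y ∉ tsupport u, ∀ w, g y w = 0 := fun y hy w => by
    simp [hg, image_eq_zero_of_notMem_tsupport hy]
  -- For `w` in a compact neighbourhood `V₀` of `z`, `φ(yw) ≠ 0` forces `y ∈ supp φ · V₀⁻¹`.
  obtain ⟨V₀, hV₀, hV₀z⟩ := exists_compact_mem_nhds z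
  have hK' : IsCompact (tsupport φ * V₀⁻¹) := φ.hasCompactSupport.mul hV₀.inv
  have hp0 : ∀ᶠ w in 𝓝 z, ∀ y ∉ tsupport φ * V₀⁻¹, φ (y * w) = 0 := by
    filter_upwards [hV₀z] with w hw y hy
    refine image_eq_zero_of_notMem_tsupport fun h => hy ?_
    simpa using Set.mul_mem_mul h (Set.inv_mem_inv.2 hw)
  have hai := L1.integrable_coeFn a
  have hμK : μ (tsupport u) < ∞ := u.hasCompactSupport.measure_lt_top
  have hgi : Integrable (fun y => g y z) μ :=
    (hgc.comp (by fun_prop : Continuous fun y : G => (y, z))).integrable_of_hasCompactSupport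
      (HasCompactSupport.intro u.hasCompactSupport fun y hy => hg0 y hy z)
  have hφz : Integrable (fun y => a y * φ (y * z)) μ := by
    refine (hai.norm.mul_const C).mono' (hai.1.mul ?_) (Eventually.of_forall fun y => ?_)
    · refine (Continuous.stronglyMeasurable_of_hasCompactSupport
        ((map_continuous φ).comp (continuous_mul_const z)) ?_).aestronglyMeasurable
      exact φ.hasCompactSupport.comp_homeomorph (Homeomorph.mulRight z)
    · rw [norm_mul]
      exact mul_le_mul_of_nonneg_left (hC _) (norm_nonneg _)
  -- Replacing `z` by `w` and averaging over `w` with weight `k` costs at most `ε` on each side.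
  have key : ∀ ε : ℝ, 0 < ε → ∫ y, g y z ∂μ ≤
      ∫ y, a y * φ (y * z) ∂μ + ε * (μ.real (tsupport u) + ∫ y, ‖a y‖ ∂μ) := by
    intro ε hε
    have h1 := eventually_forall_abs_sub_le hgc u.hasCompactSupport (z := z)
      (Eventually.of_forall fun w y hy => hg0 y hy w) hε
    have h2 := eventually_forall_abs_sub_le (q := fun y w => φ (y * w)) hφc hK' hp0 hε
    obtain ⟨k, hk, hkV, hk1⟩ := exists_cc_integral_eq_one μ (h1.and h2)
    have hkg : ∀ y, |∫ w, g y w * k w ∂μ - g y z| ≤ (tsupport u).indicator (fun _ => ε) y :=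
      fun y => abs_integral_mul_sub_le μ hk hk1
        (hgc.comp (by fun_prop : Continuous fun w : G => (y, w))) fun w hw => by
          by_contra hcon
          exact hw (hkV w fun h => hcon (h.1 y))
    have hkp : ∀ y, |∫ w, φ (y * w) * k w ∂μ - φ (y * z)| ≤ ε := fun y =>
      abs_integral_mul_sub_le μ hk hk1
        ((map_continuous φ).comp (continuous_const_mul y)) fun w hw => by
          by_contra hcon
          refine hw (hkV w fun h => hcon ((h.2 y).trans ?_))
          exact Set.indicator_le_self' (fun _ _ => hε.le) _
    have h3 := integral_mul_convLp μ (rePairing G θ hθ) φ k (ccLp 1 μ u)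
    have h4 := integral_mul_convLp μ (Pairing.realMul G) φ k a
    have h5 : ∫ x, φ x * (rePairing G θ hθ).convLp ENNReal.one_ne_top (ccLp 1 μ u)
          (ccLp 1 μ k) x ∂μ ≤
        ∫ x, φ x * (Pairing.realMul G).convLp ENNReal.one_ne_top a (ccLp 1 μ k) x ∂μ := by
      have hb : ∀ b : Lp ℝ 1 μ, Integrable (fun x => φ x * b x) μ := fun b =>
        (L1.integrable_coeFn b).bdd_mul (c := C)
          (φ.continuous.stronglyMeasurable_of_hasCompactSupport
            φ.hasCompactSupport).aestronglyMeasurable (Eventually.of_forall hC)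
      refine integral_mono_ae (hb _) (hb _) ?_
      filter_upwards [ae_rePairing_convLp_le hd hθ hk] with x hx
      exact mul_le_mul_of_nonneg_left hx (hφ x)
    have e3 : (fun y => ∫ w, φ (y * w) * rePairing G θ hθ w (ccLp 1 μ u y) (k w) ∂μ)
        =ᵐ[μ] fun y => ∫ w, g y w * k w ∂μ := by
      filter_upwards [coeFn_ccLp 1 (μ := μ) u] with y hy
      simp only [hy, rePairing_apply, hg, mul_assoc]
    have e4 : (fun y => ∫ w, φ (y * w) * Pairing.realMul G w (a y) (k w) ∂μ)
        = fun y => a y * ∫ w, φ (y * w) * k w ∂μ := by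
      ext1 y
      rw [← integral_const_mul]
      simp only [Pairing.realMul_apply, mul_left_comm]
    have hi3 := h3.1.congr e3
    have hi4 := h4.1
    rw [h3.2, h4.2, integral_congr_ae e3] at h5
    rw [e4] at hi4 h5
    have hKi : Integrable ((tsupport u).indicator fun _ => ε) μ :=
      (integrable_indicator_iff u.hasCompactSupport.measurableSet).2 (integrableOn_const hμK.ne)
    have h6 : ∫ y, g y z ∂μ ≤ ∫ y, (∫ w, g y w * k w ∂μ) ∂μ + ε * μ.real (tsupport u) := by
      have := integral_mono hgi (hi3.add hKi) fun y => by
        have := (abs_le.1 (hkg y)).1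
        simp only [Pi.add_apply]
        linarith
      rw [integral_add' hi3 hKi, integral_indicator_const _ u.hasCompactSupport.measurableSet,
        smul_eq_mul] at this
      linarith
    have h7 : ∫ y, a y * ∫ w, φ (y * w) * k w ∂μ ∂μ ≤
        ∫ y, a y * φ (y * z) ∂μ + ε * ∫ y, ‖a y‖ ∂μ := by
      rw [← integral_const_mul, ← integral_add hφz (hai.norm.const_mul ε)]
      refine integral_mono hi4 (hφz.add (hai.norm.const_mul ε)) fun y => ?_
      have h8 : a y * (∫ w, φ (y * w) * k w ∂μ - φ (y * z)) ≤ ‖a y‖ * ε := by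
        refine (le_abs_self _).trans ?_
        rw [abs_mul]
        exact mul_le_mul_of_nonneg_left (hkp y) (abs_nonneg _)
      simp only
      linarith
    linarith
  refine le_of_forall_pos_le_add fun η hη => ?_
  have hn : 0 ≤ μ.real (tsupport u) + ∫ y, ‖a y‖ ∂μ :=
    add_nonneg measureReal_nonneg (integral_nonneg fun y => norm_nonneg _)
  refine (key (η / (μ.real (tsupport u) + ∫ y, ‖a y‖ ∂μ + 1)) (by positivity)).trans ?_
  gcongr
  rw [div_mul_eq_mul_div, div_le_iff₀ (by positivity)]
  nlinarith

lemma ae_re_le {u : C_c(G, Ruc G)} {a : Lp ℝ 1 μ}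
    (hd : IsDominatedBy μ (R μ (ccLp 1 μ u)) a) {θ : ℂ} (hθ : ‖θ‖ ≤ 1) (z : G) :
    ∀ᵐ y ∂μ, (θ * (u y : G →ᵇ ℂ) z).re ≤ a y := by
  have hai := L1.integrable_coeFn a
  have hr : Integrable (fun y => (θ * (u y : G →ᵇ ℂ) z).re) μ := by
    refine Continuous.integrable_of_hasCompactSupport ?_
      (HasCompactSupport.intro u.hasCompactSupport fun y hy => ?_)
    · exact ((Complex.reCLM.comp (ContinuousLinearMap.mul ℝ ℂ θ)).comp (evalL z)).continuous.comp
        (map_continuous u)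
    · simp [image_eq_zero_of_notMem_tsupport hy]
  have h1 := ae_nonneg_of_integral_mul_nonneg (hai.sub hr) fun ψ hψ => by
    let φ : C_c(G, ℝ) := ⟨⟨fun x => ψ (x * z⁻¹), (map_continuous ψ).comp (continuous_mul_const _)⟩,
      ψ.hasCompactSupport.comp_homeomorph (Homeomorph.mulRight z⁻¹)⟩
    have h2 := integral_mul_re_le hd hθ z (φ := φ) fun x => hψ _
    have e : ∀ y, φ (y * z) = ψ y := fun y => congrArg ψ (by simp)
    simp only [e] at h2
    obtain ⟨C, hC⟩ := ψ.hasCompactSupport.exists_bound_of_continuous ψ.continuous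
    have hb : ∀ {b : G → ℝ}, Integrable b μ → Integrable (fun x => ψ x * b x) μ := fun hb =>
      hb.bdd_mul (c := C) (ψ.continuous.stronglyMeasurable_of_hasCompactSupport
        ψ.hasCompactSupport).aestronglyMeasurable (Eventually.of_forall hC)
    simp only [Pi.sub_apply, mul_sub]
    rw [integral_sub (hb hai) (hb hr), sub_nonneg]
    simpa only [mul_comm] using h2
  filter_upwards [h1] with y hy
  simpa using hy

omit [LocallyCompactSpace G] [MeasurableSpace G] [BorelSpace G] [T2Space G] in
omit [LocallyCompactSpace G] [MeasurableSpace G] [BorelSpace G] [T2Space G] in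
lemma Ruc.exists_re_ge (v : Ruc G) {δ : ℝ} (hδ : 0 < δ) :
    ∃ (z : G) (θ : ℂ), ‖θ‖ ≤ 1 ∧ ‖v‖ - δ ≤ (θ * (v : G →ᵇ ℂ) z).re := by
  obtain ⟨z, hz⟩ : ∃ z, ‖v‖ - δ ≤ ‖(v : G →ᵇ ℂ) z‖ := by
    by_contra! hcon
    have := Ruc.norm_le_of_apply ((norm_nonneg _).trans (hcon 1).le) fun z => (hcon z).le
    linarith
  obtain ⟨θ, hθ, he⟩ := RCLike.exists_norm_eq_mul_self ((v : G →ᵇ ℂ) z)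
  refine ⟨z, θ, hθ.le, hz.trans_eq ?_⟩
  rw [← he]
  exact (Complex.ofReal_re _).symm

/-- The norm of `u(y)` is the supremum of `Re (θ u(y)(z))`; as the range of `u` is separable,
countably many `(θ, z)` suffice. -/
lemma ae_norm_le {u : C_c(G, Ruc G)} {a : Lp ℝ 1 μ}
    (hd : IsDominatedBy μ (R μ (ccLp 1 μ u)) a) : ∀ᵐ y ∂μ, ‖u y‖ ≤ a y := by
  obtain ⟨c, hc, hcu⟩ := (u.continuous.stronglyMeasurable_of_hasCompactSupport
    u.hasCompactSupport).isSeparable_range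
  choose z θ hθ hz using fun (v : Ruc G) (n : ℕ) =>
    Ruc.exists_re_ge v (Nat.one_div_pos_of_nat (n := n) (α := ℝ))
  have h1 : ∀ᵐ y ∂μ, ∀ v ∈ c, ∀ n, (θ v n * (u y : G →ᵇ ℂ) (z v n)).re ≤ a y :=
    (ae_ball_iff hc).2 fun v _ => ae_all_iff.2 fun n => ae_re_le hd (hθ v n) (z v n)
  filter_upwards [h1] with y hy
  refine le_of_forall_pos_le_add fun ε hε => ?_
  obtain ⟨v, hvc, hv⟩ := Metric.mem_closure_iff.1 (hcu (Set.mem_range_self y)) (ε / 3)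
    (by positivity)
  obtain ⟨n, hn⟩ := exists_nat_one_div_lt (show 0 < ε / 3 by positivity)
  have h2 := hy v hvc n
  have h3 := hz v n
  have hv' : ‖u y - v‖ < ε / 3 := by simpa [dist_eq_norm] using hv
  have h4 : ‖u y‖ ≤ ‖v‖ + ‖u y - v‖ := by
    have := norm_add_le v (u y - v)
    rwa [add_sub_cancel] at this
  have h5 : (θ v n * (v : G →ᵇ ℂ) (z v n)).re - (θ v n * (u y : G →ᵇ ℂ) (z v n)).re
      ≤ ‖u y - v‖ := by
    rw [← Complex.sub_re, ← mul_sub]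
    refine (Complex.re_le_norm _).trans ?_
    rw [norm_mul, norm_sub_rev]
    exact (mul_le_of_le_one_left (norm_nonneg _) (hθ v n)).trans
      (Ruc.norm_apply_le (u y - v) (z v n))
  linarith

lemma norm_le_of_isDominatedBy_cc {u : C_c(G, Ruc G)} {a : Lp ℝ 1 μ}
    (hd : IsDominatedBy μ (R μ (ccLp 1 μ u)) a) : ‖ccLp 1 μ u‖ ≤ ‖a‖ := by
  rw [L1.norm_eq_integral_norm, L1.norm_eq_integral_norm]
  refine integral_mono_ae (L1.integrable_coeFn _).norm (L1.integrable_coeFn _).norm ?_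
  filter_upwards [ae_norm_le hd, coeFn_ccLp 1 (μ := μ) u] with y h1 h2
  rw [h2]
  exact h1.trans (Real.le_norm_self _)

/-- Every dominating function of `R(f)` has norm at least `‖f‖`, by approximation of `f` by
functions of compact support. -/
lemma norm_le_of_isDominatedBy {f : TwistedL1 μ} {a : Lp ℝ 1 μ}
    (hd : IsDominatedBy μ (R μ f) a) : ‖f‖ ≤ ‖a‖ := by
  refine le_of_forall_pos_le_add fun ε hε => ?_
  obtain ⟨u, hu⟩ := exists_cc_eLpNorm_sub_le ENNReal.one_ne_top (Lp.memLp f)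
    (ε := ENNReal.ofReal (ε / 2)) (by simpa using hε)
  have h1 : ‖f - ccLp 1 μ u‖ ≤ ε / 2 := by
    rw [Lp.norm_def]
    refine ENNReal.toReal_le_of_le_ofReal (by positivity) (le_trans (le_of_eq ?_) hu)
    refine eLpNorm_congr_ae ?_
    filter_upwards [Lp.coeFn_sub f (ccLp 1 μ u), coeFn_ccLp 1 (μ := μ) u] with x h2 h3
    rw [h2, Pi.sub_apply, Pi.sub_apply, h3]
  have h2 := norm_le_of_isDominatedBy_cc (hd.of_sub (g := ccLp 1 μ u))
  have h3 := norm_add_le a (normL1 (ccLp 1 μ u - f))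
  rw [norm_normL1, norm_sub_rev] at h3
  have h4 := norm_add_le (f - ccLp 1 μ u) (ccLp 1 μ u)
  rw [sub_add_cancel] at h4
  linarith

lemma R_mem_CD (f : TwistedL1 μ) : R μ f ∈ CD μ := ⟨_, isDominatedBy_R f⟩

lemma cdNorm_R (f : TwistedL1 μ) : cdNorm μ (R μ f) = ‖f‖ := by
  refine le_antisymm (csInf_le ⟨‖f‖, ?_⟩ ⟨_, isDominatedBy_R f, norm_normL1 f⟩)
    (le_csInf ⟨_, _, isDominatedBy_R f, rfl⟩ ?_)
  · rintro _ ⟨a, ha, rfl⟩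
    exact norm_le_of_isDominatedBy ha
  · rintro _ ⟨a, ha, rfl⟩
    exact norm_le_of_isDominatedBy ha

end LowerBound

end ConvDom

end

theorem mainTheorem7 {G : Type*} [Group G] [TopologicalSpace G] [IsTopologicalGroup G]
    [LocallyCompactSpace G] [T2Space G] [MeasurableSpace G] [BorelSpace G]
    (μ : Measure G) [μ.IsHaarMeasure] [μ.Regular] :
    -- `R` is the bounded linear map determined by `a ⊗ m ↦ λ(a) ∘ D^m`
    (∀ (a : Lp ℂ 1 μ) (m : ConvDom.Ruc G),
      ConvDom.R μ (ConvDom.tensor μ a m) = ConvDom.lamInt μ a ∘L ConvDom.mulOp μ m) ∧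
    (∀ S : ConvDom.TwistedL1 μ →L[ℂ] ConvDom.L2 μ →L[ℂ] ConvDom.L2 μ,
      (∀ (a : Lp ℂ 1 μ) (m : ConvDom.Ruc G),
        S (ConvDom.tensor μ a m) = ConvDom.lamInt μ a ∘L ConvDom.mulOp μ m) →
      S = ConvDom.R μ) ∧
    -- the twisted convolution is defined on `L¹(G, Ruc(G))` and `R` is multiplicative
    (∀ h f : ConvDom.TwistedL1 μ,
      (∀ᵐ x ∂μ, Integrable (ConvDom.twistedIntegrand h f x) μ) ∧
      ∃ hi : Integrable (ConvDom.twistedConv μ h f) μ,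
        ConvDom.R μ (hi.toL1 (ConvDom.twistedConv μ h f)) =
          ConvDom.R μ h ∘L ConvDom.R μ f) ∧
    -- the involution is defined on `L¹(G, Ruc(G))` and `R` preserves it
    (∀ h : ConvDom.TwistedL1 μ,
      ∃ hi : Integrable (ConvDom.twistedStar h) μ,
        ConvDom.R μ (hi.toL1 (ConvDom.twistedStar h)) =
          ContinuousLinearMap.adjoint (ConvDom.R μ h)) ∧
    -- `R` takes values in `CD`, is isometric for the `CD`-norm, and has image `CD_reg`
    (∀ f : ConvDom.TwistedL1 μ,
      ConvDom.R μ f ∈ ConvDom.CD μ ∧ ConvDom.cdNorm μ (ConvDom.R μ f) = ‖f‖) ∧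
    Set.range (ConvDom.R μ) = ConvDom.CDreg μ ∧
    (ConvDom.CDreg μ : Set (ConvDom.L2 μ →L[ℂ] ConvDom.L2 μ)) ⊆ ConvDom.CD μ := by
  refine ⟨ConvDom.R_tensor μ, ConvDom.eq_R_of_tensor μ, fun h f => ⟨?_, ?_⟩, fun h => ?_,
    fun f => ⟨ConvDom.R_mem_CD f, ConvDom.cdNorm_R f⟩, (LinearMap.coe_range _).symm, ?_⟩
  · exact (ConvDom.ae_integrable_twistedIntegrand μ h f).mono fun _ hx => hx.1
  · exact ⟨ConvDom.integrable_twistedConv μ h f, ConvDom.R_twistedConv μ h f⟩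
  · exact ⟨ConvDom.integrable_twistedStar μ h, ConvDom.R_twistedStar μ h⟩
  · rintro _ ⟨f, rfl⟩
    exact ConvDom.R_mem_CD f
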